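/- Let $\gamma_1 > \gamma_2 > 0$ and $0 < s < 1/2$ be fixed. For $k \ge 2$ with $\gamma_1 k^{-1/2} < 1$, let $p = \gamma_1 k^{-1/2}$ and $q = \gamma_2 k^{-1/2}$, and let $A \sim \mathsf{SignedBlock}_k(p, q, s)$ be the signed adjacency matrix of a random signed graph on the vertices $\{1, \dots, 2k\}$, split into the communities $\{1, \dots, k\}$ and $\{k+1, \dots, 2k\}$: $A$ is symmetric with zero diagonal, and for $i < j$ its entries are $a_{ij} = P_{ij}(1 - 2S_{ij})$, where all the variables $P_{ij}, S_{ij}$ $(i<j)$ are mutually independent Bernoulli variables, with $\Pr(P_{ij} = 1) = p$ and $\Pr(S_{ij} = 1) = s$ if $i, j$ lie in the same community, and $\Pr(P_{ij} = 1) = q$ and $\Pr(S_{ij} = 1) = 1 - s$ otherwise. Write $\lambda_1(A) \le \lambda_2(A) \le \dots \le \lambda_{2k}(A)$ for the eigenvalues of $A$, with multiplicity. Then there exist a constant $C > 0$ and a deterministic sequence $\varepsilon_k = o(1)$ as $k \to \infty$, depending only on $\gamma_1, \gamma_2, s$, such that for every $k \ge 2$ with $\gamma_1 k^{-1/2} <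 1$, with probability at least $1 - k^{-2}$, the following inequalities all hold: \begin{align*} |\lambda_{2k}(A) - (1-2s)(\gamma_1+\gamma_2)\sqrt{k}| &\le C k^{1/4} + \varepsilon_k,\\ |\lambda_{2k-1}(A) - (1-2s)(\gamma_1-\gamma_2)\sqrt{k}| &\le C k^{1/4} + \varepsilon_k,\\ |\lambda_\ell(A)| &\le C k^{1/4} + \varepsilon_k \quad \text{for all } 1 \le \ell < 2k-1. \end{align*} -/

import Mathlib

open MeasureTheory ProbabilityTheory Filter Topology

/-- The `σ`-algebra on `n × n` real matrices, generated by the entries. -/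
instance matrixMeasurableSpace (n : ℕ) : MeasurableSpace (Matrix (Fin n) (Fin n) ℝ) :=
  inferInstanceAs (MeasurableSpace (Fin n → Fin n → ℝ))

/-- The unordered pairs of distinct elements of `Fin n`, each listed with its smaller element
first. -/
abbrev VertexPair (n : ℕ) : Type := {e : Fin n × Fin n // e.1 < e.2}

/-- The signed adjacency matrix of the signed graph encoded by `ω`. The first bit of `ω {i, j}`
says whether `{i, j}` is an edge, the second whether its sign is negative. The entry is
`P (1 - 2 S)`, where `P` and `S` are the two bits read as numbers in `{0, 1}`. -/
noncomputable def signedAdjacency {n : ℕ} (ω : VertexPair n → Bool × Bool) :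
    Matrix (Fin n) (Fin n) ℝ :=
  let a : VertexPair n → ℝ := fun e =>
    (if (ω e).1 then 1 else 0) * (1 - 2 * (if (ω e).2 then 1 else 0))
  Matrix.of fun i j =>
    if h : i < j then a ⟨(i, j), h⟩ else if h : j < i then a ⟨(j, i), h⟩ else 0

/-- The signed inhomogeneous Erdős–Rényi model, as the law of the signed adjacency matrix. For each
pair `i < j`, independently of all others, `{i, j}` is an edge with probability `P i j` and
its sign is negative with probability `S i j`, all these choices being mutually independent.
(`P` and `S` are meant to be symmetric with zero diagonal; the entries with `i < j` are used.) -/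
noncomputable def signedErdosRenyi {n : ℕ} (P S : Matrix (Fin n) (Fin n) unitInterval) :
    Measure (Matrix (Fin n) (Fin n) ℝ) :=
  (Measure.pi fun e : VertexPair n =>
    (bernoulliMeasure true false (P e.1.1 e.1.2)).prod
      (bernoulliMeasure true false (S e.1.1 e.1.2))).map signedAdjacency

/-- Extension of an `m × m` matrix of probabilities to the vertices of a graph whose communities
are given by `c`, with zero diagonal. -/
def blockExtend {n m : ℕ} (c : Fin n → Fin m) (M : Matrix (Fin m) (Fin m) unitInterval) :
    Matrix (Fin n) (Fin n) unitInterval :=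
  Matrix.of fun i j => if i = j then 0 else M (c i) (c j)

/-- The even bipartition of `2k` vertices into the first `k` and the last `k` ones. -/
def bisection (k : ℕ) (i : Fin (2 * k)) : Fin 2 := if (i : ℕ) < k then 0 else 1

/-- The signed stochastic bisection model `SignedBlock_k(p, q, s)` on `2k` vertices: edge
probability `p` inside the communities and `q` across, probability of a negative sign `s` inside
the communities and `1 - s` across. -/
noncomputable def signedBlock (k : ℕ) (p q s : unitInterval) :
    Measure (Matrix (Fin (2 * k)) (Fin (2 * k)) ℝ) :=
  signedErdosRenyi
    (blockExtend (bisection k) !![p, q; q, p])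
    (blockExtend (bisection k) !![s, unitInterval.symm s; unitInterval.symm s, s])

/-- The `ℓ`-th eigenvalue `λ_ℓ(X)`, `1 ≤ ℓ ≤ n`, of a symmetric `n × n` matrix, in the ascending
order `λ_1(X) ≤ ⋯ ≤ λ_n(X)` with multiplicity (`Matrix.IsHermitian.eigenvalues₀` is the
list in descending order, indexed from `0`). The value is `0` for other `ℓ`. -/
noncomputable def ascEigenvalue {n : ℕ} {X : Matrix (Fin n) (Fin n) ℝ} (hX : X.IsHermitian)
    (ℓ : ℕ) : ℝ :=
  if h : 1 ≤ ℓ ∧ ℓ ≤ n then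
    hX.eigenvalues₀ ⟨n - ℓ, by rw [Fintype.card_fin]; omega⟩
  else 0

/-! Split the matrix into its mean and a centred noise. With `u` the normalized vector of community
signs and `v` the normalized constant vector, the quadratic form of the mean is `(1-2s)(p+q)k (u ·
x)² + (1-2s)(p-q)k (v · x)²` minus `(1-2s)p |x|²`, the last term coming from the zero diagonal.
Since `pk = γ₁√k` and `qk = γ₂√k`, the two coefficients are the predicted outliers, and the min-max
principle (`eigenvalues₀_near_rank_two`) reduces everything to a bound of order `k^(1/4)` on the
noise.

The noise is a sparse symmetric matrix with row variances of order `kp ~ √k`, so the task is a norm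
bound of order `√(np)` without logarithmic loss, where `n = 2k`. It comes from the trace method with
moments of order `2m ~ √k`. Only good walks contribute to the expected trace, and one with `t`
distinct vertices contributes at most `p^(t-1)`. Grouped by shape, these weights are dominated by
the number of good walks on only `r ≥ np + 2m` vertices, up to the factor `n/r`
(`sum_isGoodWalk_le`).

That number is not found by combinatorics. It is at most the expected trace for a dense bounded `r ×
r` matrix whose moments of order at least two are all at least one (`card_isGoodWalk_le_integral`),
and a net argument with subgaussian tails bounds this trace by `r^(m+1) K^r`
(`integral_trace_pow_le_of_bounded`). With `r = bm` and `b` constant, `K^r` costs only a constant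
factor in the norm, and Markov's inequality gives `quadratic_bound_probability`. -/

/-! ### Eigenvalues and quadratic forms: min-max and rank-two perturbation. -/

open Matrix in
/-- An orthonormal eigenbasis of a real symmetric matrix, listed in the order of
`Matrix.IsHermitian.eigenvalues₀`, in terms of dot products. -/
theorem Matrix.IsHermitian.exists_eigenbasis {n : ℕ} {A : Matrix (Fin n) (Fin n) ℝ}
    (hA : A.IsHermitian) :
    ∃ e : Fin (Fintype.card (Fin n)) → Fin n → ℝ,
      (∀ j, A *ᵥ e j = hA.eigenvalues₀ j • e j) ∧
      (∀ i j, e i ⬝ᵥ e j = if i = j then 1 else 0) ∧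
      (∀ x, x ⬝ᵥ x = ∑ j, (e j ⬝ᵥ x) ^ 2) ∧
      (∀ x, x ⬝ᵥ (A *ᵥ x) = ∑ j, hA.eigenvalues₀ j * (e j ⬝ᵥ x) ^ 2) := by
  have hT := isSymmetric_toEuclideanLin_iff.mpr hA
  let b := hT.eigenvectorBasis finrank_euclideanSpace
  have hin : ∀ x y : Fin n → ℝ, inner ℝ (WithLp.toLp 2 x) (WithLp.toLp 2 y) = x ⬝ᵥ y := by
    intro x y
    rw [EuclideanSpace.inner_toLp_toLp, dotProduct_comm]
    simp
  have hb : ∀ j, A *ᵥ (b j).ofLp = hA.eigenvalues₀ j • (b j).ofLp := by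
    intro j
    have := hT.apply_eigenvectorBasis finrank_euclideanSpace j
    exact congrArg WithLp.ofLp this
  have hx : ∀ x y : Fin n → ℝ, x ⬝ᵥ y = ∑ j, ((b j).ofLp ⬝ᵥ x) * ((b j).ofLp ⬝ᵥ y) := by
    intro x y
    rw [← hin, ← b.sum_inner_mul_inner]
    refine Finset.sum_congr rfl fun j _ => ?_
    have h1 := hin x (b j).ofLp
    have h2 := hin (b j).ofLp y
    simp only [WithLp.toLp_ofLp] at h1 h2
    rw [h1, h2, dotProduct_comm x]
  refine ⟨fun j => (b j).ofLp, hb, ?_, ?_, ?_⟩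
  · intro i j
    rw [← hin]
    simpa using orthonormal_iff_ite.mp b.orthonormal i j
  · intro x
    rw [hx]
    exact Finset.sum_congr rfl fun j _ => by ring
  · intro x
    rw [hx]
    refine Finset.sum_congr rfl fun j _ => ?_
    have : (b j).ofLp ⬝ᵥ (A *ᵥ x) = hA.eigenvalues₀ j * ((b j).ofLp ⬝ᵥ x) := by
      have hAt : A.IsSymm := by simpa using hA
      rw [dotProduct_mulVec, ← mulVec_transpose, hAt.eq, hb, smul_dotProduct, smul_eq_mul]
    rw [this]; ring

open Matrix in
/-- Lower half of the min-max principle: a quadratic form that is at least `t |x|²` on a subspace of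
dimension larger than `j` has `j`-th eigenvalue (descending order, from `0`) at least `t`. -/
theorem Matrix.IsHermitian.le_eigenvalues₀ {n : ℕ} {A : Matrix (Fin n) (Fin n) ℝ}
    (hA : A.IsHermitian) (j : Fin (Fintype.card (Fin n))) {t : ℝ} (W : Submodule ℝ (Fin n → ℝ))
    (hW : (j : ℕ) < Module.finrank ℝ W) (h : ∀ x ∈ W, t * (x ⬝ᵥ x) ≤ x ⬝ᵥ (A *ᵥ x)) :
    t ≤ hA.eigenvalues₀ j := by
  obtain ⟨e, -, -, he1, he2⟩ := hA.exists_eigenbasis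
  -- Coordinates along the top `j` eigenvectors. As `W` has dimension above `j`, some nonzero vector
  -- of `W` is orthogonal to all of them, and the form there sees only eigenvalues of index at least
  -- `j`.
  let φ : (Fin n → ℝ) →ₗ[ℝ] (Fin (j : ℕ) → ℝ) :=
    LinearMap.pi fun i => dotProductBilin ℝ ℝ (e ⟨i, i.2.trans j.2⟩)
  have hφ : ∀ x i, φ x i = e ⟨i, i.2.trans j.2⟩ ⬝ᵥ x := fun x i => rfl
  have hker : LinearMap.ker (φ ∘ₗ W.subtype) ≠ ⊥ :=
    LinearMap.ker_ne_bot_of_finrank_lt (by simpa using hW)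
  obtain ⟨x, hx, hx0⟩ := Submodule.exists_mem_ne_zero_of_ne_bot hker
  have hx' : ∀ i : Fin (Fintype.card (Fin n)), i < j → e i ⬝ᵥ x.1 = 0 := by
    intro i hi
    have := congrFun (LinearMap.mem_ker.mp hx) ⟨i, hi⟩
    simpa [hφ] using this
  have hpos : 0 < x.1 ⬝ᵥ x.1 := by
    have h0 : x.1 ≠ 0 := by simpa using hx0
    have := dotProduct_star_self_pos_iff.mpr h0
    simpa using this
  have h1 := h x.1 x.2
  have h2 : x.1 ⬝ᵥ (A *ᵥ x.1) ≤ hA.eigenvalues₀ j * (x.1 ⬝ᵥ x.1) := by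
    rw [he2, he1, Finset.mul_sum]
    refine Finset.sum_le_sum fun i _ => ?_
    rcases lt_or_ge i j with hi | hi
    · simp [hx' i hi]
    · exact mul_le_mul_of_nonneg_right (hA.eigenvalues₀_antitone hi) (sq_nonneg _)
  exact le_of_mul_le_mul_right (h1.trans h2) hpos

open Matrix in
/-- Upper half of the min-max principle: a quadratic form that is at most `t |x|²` on the kernel of a
linear map of rank at most `j` has `j`-th eigenvalue (descending order, from `0`) at most `t`. -/
theorem Matrix.IsHermitian.eigenvalues₀_le {n : ℕ} {A : Matrix (Fin n) (Fin n) ℝ}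
    (hA : A.IsHermitian) (j : Fin (Fintype.card (Fin n))) {t : ℝ} {d : ℕ} (hd : d ≤ j)
    (φ : (Fin n → ℝ) →ₗ[ℝ] (Fin d → ℝ))
    (h : ∀ x, φ x = 0 → x ⬝ᵥ (A *ᵥ x) ≤ t * (x ⬝ᵥ x)) :
    hA.eigenvalues₀ j ≤ t := by
  obtain ⟨e, -, he0, he1, he2⟩ := hA.exists_eigenbasis
  let f : Fin ((j : ℕ) + 1) → Fin (Fintype.card (Fin n)) := fun i => ⟨i, by omega⟩
  -- Parametrizes the span of the top `j + 1` eigenvectors, which meets the kernel of `φ`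
  -- nontrivially because `d ≤ j`.
  let ψ : (Fin ((j : ℕ) + 1) → ℝ) →ₗ[ℝ] (Fin n → ℝ) :=
    ∑ i, (LinearMap.toSpanSingleton ℝ _ (e (f i))) ∘ₗ LinearMap.proj i
  have hψ : ∀ c, ψ c = ∑ i, c i • e (f i) := fun c => by simp [ψ]
  have hker : LinearMap.ker (φ ∘ₗ ψ) ≠ ⊥ :=
    LinearMap.ker_ne_bot_of_finrank_lt (by simp; omega)
  obtain ⟨c, hc, hc0⟩ := Submodule.exists_mem_ne_zero_of_ne_bot hker
  have hco : ∀ l, e l ⬝ᵥ ψ c = ∑ i, c i * if l = f i then 1 else 0 := by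
    intro l
    rw [hψ, dotProduct_sum]
    exact Finset.sum_congr rfl fun i _ => by rw [dotProduct_smul, he0, smul_eq_mul]
  have hcf : ∀ i, e (f i) ⬝ᵥ ψ c = c i := by
    intro i
    have : ∀ i', (f i = f i') ↔ i = i' := fun i' => by simp [f, Fin.ext_iff]
    rw [hco]; simp [this]
  have hpos : 0 < ψ c ⬝ᵥ ψ c := by
    have h0 : ψ c ≠ 0 := by
      intro h0
      apply hc0
      ext i
      rw [← hcf i, h0]; simp
    have := dotProduct_star_self_pos_iff.mpr h0
    simpa using this
  have h1 := h (ψ c) hc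
  have h2 : hA.eigenvalues₀ j * (ψ c ⬝ᵥ ψ c) ≤ ψ c ⬝ᵥ (A *ᵥ ψ c) := by
    rw [he2, he1, Finset.mul_sum]
    refine Finset.sum_le_sum fun i _ => ?_
    rcases le_or_gt i j with hi | hi
    · exact mul_le_mul_of_nonneg_right (hA.eigenvalues₀_antitone hi) (sq_nonneg _)
    · have : e i ⬝ᵥ ψ c = 0 := by
        rw [hco]
        refine Finset.sum_eq_zero fun l _ => ?_
        have : i ≠ f l := by
          intro h
          have := l.2
          rw [h] at hi
          simp only [f, Fin.lt_def] at hi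
          omega
        simp [this]
      simp [this]
  exact le_of_mul_le_mul_right (h2.trans h1) hpos

open Matrix in
theorem Matrix.IsHermitian.trace_pow {n : ℕ} {A : Matrix (Fin n) (Fin n) ℝ}
    (hA : A.IsHermitian) (L : ℕ) : (A ^ L).trace = ∑ i, hA.eigenvalues i ^ L := by
  conv_lhs => rw [hA.spectral_theorem, ← map_pow, Unitary.conjStarAlgAut_apply, trace_mul_cycle,
    Unitary.coe_star_mul_self, one_mul, diagonal_pow, trace_diagonal]
  simp

open Matrix in
/-- If all eigenvalues of `A` are at most `ρ` in absolute value, so is its quadratic form. -/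
theorem Matrix.IsHermitian.abs_quadratic_le {n : ℕ} {A : Matrix (Fin n) (Fin n) ℝ}
    (hA : A.IsHermitian) {ρ : ℝ} (h : ∀ i, |hA.eigenvalues i| ≤ ρ) (x : Fin n → ℝ) :
    |x ⬝ᵥ (A *ᵥ x)| ≤ ρ * (x ⬝ᵥ x) := by
  obtain ⟨e, -, -, he1, he2⟩ := hA.exists_eigenbasis
  have h0 : ∀ j, |hA.eigenvalues₀ j| ≤ ρ := by
    intro j
    have := h (Fintype.equivOfCardEq (Fintype.card_fin _) j)
    simpa [Matrix.IsHermitian.eigenvalues] using this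
  rw [he2, he1, Finset.mul_sum]
  refine (Finset.abs_sum_le_sum_abs _ _).trans (Finset.sum_le_sum fun j _ => ?_)
  rw [abs_mul, abs_of_nonneg (sq_nonneg (e j ⬝ᵥ x))]
  exact mul_le_mul_of_nonneg_right (h0 j) (sq_nonneg _)

-- An even power makes all terms of the trace nonnegative, so the trace dominates the power of each
-- single eigenvalue.
open Matrix in
theorem Matrix.IsHermitian.abs_quadratic_le_of_trace_pow_le {n : ℕ} {A : Matrix (Fin n) (Fin n) ℝ}
    (hA : A.IsHermitian) {ρ : ℝ} (hρ : 0 ≤ ρ) {m : ℕ} (hm : m ≠ 0)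
    (h : (A ^ (2 * m)).trace ≤ ρ ^ (2 * m)) (x : Fin n → ℝ) :
    |x ⬝ᵥ (A *ᵥ x)| ≤ ρ * (x ⬝ᵥ x) := by
  refine hA.abs_quadratic_le (fun i => ?_) x
  rw [hA.trace_pow] at h
  have h1 : |hA.eigenvalues i| ^ (2 * m) ≤ ρ ^ (2 * m) := by
    rw [(even_two_mul m).pow_abs]
    refine le_trans ?_ h
    exact Finset.single_le_sum (f := fun i => hA.eigenvalues i ^ (2 * m))
      (fun i _ => (even_two_mul m).pow_nonneg _) (Finset.mem_univ i)
  exact le_of_pow_le_pow_left₀ (by omega) hρ h1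

open Matrix in
/-- Eigenvalues of a symmetric matrix that is close, as a quadratic form, to
`α (u · x)² + β (v · x)²` with orthonormal `u`, `v` and `α ≥ β ≥ 0`. -/
theorem Matrix.IsHermitian.eigenvalues₀_near_rank_two {n : ℕ} {A : Matrix (Fin n) (Fin n) ℝ}
    (hA : A.IsHermitian) {u v : Fin n → ℝ} (hu : u ⬝ᵥ u = 1) (hv : v ⬝ᵥ v = 1)
    (huv : u ⬝ᵥ v = 0) {α β δ : ℝ} (hβ : 0 ≤ β) (hαβ : β ≤ α)
    (h : ∀ x, |x ⬝ᵥ (A *ᵥ x) - (α * (u ⬝ᵥ x) ^ 2 + β * (v ⬝ᵥ x) ^ 2)| ≤ δ * (x ⬝ᵥ x))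
    (j : Fin (Fintype.card (Fin n))) :
    |hA.eigenvalues₀ j - (if (j : ℕ) = 0 then α else if (j : ℕ) = 1 then β else 0)| ≤ δ := by
  have hvu : v ⬝ᵥ u = 0 := by rw [dotProduct_comm, huv]
  -- Bessel's inequality, from the squared norm of the component orthogonal to `u` and `v`.
  have hB : ∀ x, (u ⬝ᵥ x) ^ 2 + (v ⬝ᵥ x) ^ 2 ≤ x ⬝ᵥ x := by
    intro x
    have h0 : 0 ≤ (x - (u ⬝ᵥ x) • u - (v ⬝ᵥ x) • v) ⬝ᵥ (x - (u ⬝ᵥ x) • u - (v ⬝ᵥ x) • v) := by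
      simpa using dotProduct_star_self_nonneg (x - (u ⬝ᵥ x) • u - (v ⬝ᵥ x) • v)
    simp only [dotProduct_sub, sub_dotProduct, dotProduct_smul, smul_dotProduct, smul_eq_mul, hu,
      hv, huv, hvu, dotProduct_comm x u, dotProduct_comm x v] at h0
    linarith
  have hup := fun x => (abs_le.mp (h x)).2
  have hlo := fun x => (abs_le.mp (h x)).1
  have hj := j.2
  rw [abs_le]
  split_ifs with h0 h1
  · constructor
    · have := hA.le_eigenvalues₀ j (t := α - δ) (Submodule.span ℝ {u}) (by
        have hu0 : u ≠ 0 := by rintro rfl; simp at hu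
        rw [h0, finrank_span_singleton hu0]; norm_num) (by
        intro x hx
        obtain ⟨c, rfl⟩ := Submodule.mem_span_singleton.mp hx
        have := hlo (c • u)
        simp only [dotProduct_smul, smul_dotProduct, smul_eq_mul, hu, hvu] at this ⊢
        linarith)
      linarith
    · have := hA.eigenvalues₀_le j (t := α + δ) (d := 0) (by omega) 0 (by
        intro x _
        have h2 := hup x
        have h3 := hB x
        have h4 := mul_le_mul_of_nonneg_right hαβ (sq_nonneg (v ⬝ᵥ x))
        have h5 := mul_le_mul_of_nonneg_left h3 (hβ.trans hαβ)
        linarith)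
      linarith
  · constructor
    · have := hA.le_eigenvalues₀ j (t := β - δ) (Submodule.span ℝ (Set.range ![u, v])) (by
        have hli : LinearIndependent ℝ ![u, v] := by
          rw [LinearIndependent.pair_iff]
          intro s t hst
          have e1 := congrArg (fun y => u ⬝ᵥ y) hst
          have e2 := congrArg (fun y => v ⬝ᵥ y) hst
          simp [hu, hv, huv, hvu] at e1 e2
          exact ⟨e1, e2⟩
        rw [finrank_span_eq_card hli, h1]; simp) (by
        intro x hx
        have hx' : x ∈ Submodule.span ℝ {u, v} := by
          rw [Set.pair_comm]; simpa using hx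
        obtain ⟨c, d, rfl⟩ := Submodule.mem_span_pair.mp hx'
        have h2 := hlo (c • u + d • v)
        simp only [dotProduct_add, add_dotProduct, dotProduct_smul, smul_dotProduct, smul_eq_mul,
          hu, hv, huv, hvu] at h2 ⊢
        have h4 := mul_le_mul_of_nonneg_right hαβ (sq_nonneg c)
        linarith)
      linarith
    · have := hA.eigenvalues₀_le j (t := β + δ) (d := 1) (by omega)
        (LinearMap.pi fun _ => dotProductBilin ℝ ℝ u) (by
        intro x hx
        have hx0 : u ⬝ᵥ x = 0 := congrFun hx 0
        have h2 := hup x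
        have h3 := hB x
        rw [hx0] at h2 h3
        have h5 := mul_le_mul_of_nonneg_left h3 hβ
        linarith)
      linarith
  · constructor
    · have := hA.le_eigenvalues₀ j (t := -δ) ⊤ (by
        have := j.2
        rw [finrank_top]; simpa using this) (by
        intro x _
        have h2 := hlo x
        have h4 := mul_nonneg (hβ.trans hαβ) (sq_nonneg (u ⬝ᵥ x))
        have h5 := mul_nonneg hβ (sq_nonneg (v ⬝ᵥ x))
        linarith)
      linarith
    · have := hA.eigenvalues₀_le j (t := δ) (d := 2) (by omega)
        (LinearMap.pi fun i => dotProductBilin ℝ ℝ (![u, v] i)) (by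
        intro x hx
        have hx0 : u ⬝ᵥ x = 0 := congrFun hx 0
        have hx1 : v ⬝ᵥ x = 0 := congrFun hx 1
        have h2 := hup x
        rw [hx0, hx1] at h2
        linarith)
      linarith

/-! ### Symmetric matrices indexed by vertex pairs. -/

/-- The symmetric matrix with zero diagonal and prescribed entries above the diagonal. -/
def symMatrix {n : ℕ} (a : VertexPair n → ℝ) : Matrix (Fin n) (Fin n) ℝ :=
  Matrix.of fun i j =>
    if h : i < j then a ⟨(i, j), h⟩ else if h : j < i then a ⟨(j, i), h⟩ else 0

theorem symMatrix_self {n : ℕ} (a : VertexPair n → ℝ) (i : Fin n) : symMatrix a i i = 0 := by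
  simp [symMatrix]

theorem symMatrix_of_sym2_eq {n : ℕ} (a : VertexPair n → ℝ) {i j : Fin n} {e : VertexPair n}
    (h : s(i, j) = s(e.1.1, e.1.2)) : symMatrix a i j = a e := by
  obtain ⟨⟨x, y⟩, hxy⟩ := e
  have hxy' : x < y := hxy
  rcases Sym2.eq_iff.mp h with ⟨rfl, rfl⟩ | ⟨rfl, rfl⟩
  · simp [symMatrix, hxy']
  · simp [symMatrix, hxy', hxy'.not_gt]

theorem symMatrix_isHermitian {n : ℕ} (a : VertexPair n → ℝ) : (symMatrix a).IsHermitian := by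
  ext i j
  simp only [symMatrix, Matrix.conjTranspose_apply, Matrix.of_apply, star_trivial]
  rcases lt_trichotomy i j with h | rfl | h
  · simp [h, h.not_gt]
  · simp
  · simp [h, h.not_gt]

theorem exists_vertexPair {n : ℕ} {i j : Fin n} (h : i ≠ j) :
    ∃ e : VertexPair n, s(i, j) = s(e.1.1, e.1.2) := by
  rcases lt_or_gt_of_ne h with h | h
  · exact ⟨⟨(i, j), h⟩, rfl⟩
  · exact ⟨⟨(j, i), h⟩, Sym2.eq_swap⟩

theorem vertexPair_ext {n : ℕ} {e f : VertexPair n}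
    (h : s(e.1.1, e.1.2) = s(f.1.1, f.1.2)) : e = f := by
  obtain ⟨⟨x, y⟩, hxy⟩ := e
  obtain ⟨⟨z, w⟩, hzw⟩ := f
  have hxy' : x < y := hxy
  have hzw' : z < w := hzw
  rcases Sym2.eq_iff.mp h with ⟨h1, h2⟩ | ⟨h1, h2⟩
  · simp only at h1 h2; subst h1 h2; rfl
  · simp only at h1 h2; subst h1 h2; exact absurd hxy' hzw'.not_gt

/-! ### Traces of powers and closed walks. -/

section Trace

/-- The arbitrary end weight `F` lets the induction peel off the first step by absorbing it into the
weight. Taking `F i j = M j i` later closes the walk. -/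
theorem sum_pow_mul_eq_sum_walk {V : Type*} [Fintype V] [DecidableEq V] (M : Matrix V V ℝ) (L : ℕ) :
    ∀ F : V → V → ℝ, ∑ i, ∑ j, (M ^ L) i j * F i j =
      ∑ u : Fin (L + 1) → V, (∏ i : Fin L, M (u i.castSucc) (u i.succ)) * F (u 0) (u (Fin.last L)) := by
  induction L with
  | zero =>
    intro F
    rw [← (Equiv.funUnique (Fin 1) V).symm.sum_comp]
    simp [Matrix.one_apply, Equiv.funUnique]
  | succ L ih =>
    intro F
    have h1 : ∑ i, ∑ j, (M ^ (L + 1)) i j * F i j =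
        ∑ k, ∑ j, (M ^ L) k j * ∑ i, M i k * F i j := by
      simp only [pow_succ', Matrix.mul_apply, Finset.sum_mul, Finset.mul_sum]
      refine (Finset.sum_congr rfl fun _ _ => Finset.sum_comm).trans ?_
      rw [Finset.sum_comm]
      refine Finset.sum_congr rfl fun k _ => Finset.sum_comm.trans ?_
      exact Finset.sum_congr rfl fun _ _ => Finset.sum_congr rfl fun _ _ => by ring
    rw [h1, ih, ← (Fin.consEquiv fun _ : Fin (L + 2) => V).sum_comp, Fintype.sum_prod_type_right]
    refine Finset.sum_congr rfl fun u _ => ?_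
    rw [Finset.mul_sum]
    refine Finset.sum_congr rfl fun i _ => ?_
    simp only [Fin.consEquiv_apply, Fin.prod_univ_succ (n := L), Fin.castSucc_zero, Fin.cons_zero,
      Fin.cons_succ, ← Fin.succ_last, ← Fin.succ_castSucc]
    ring

/-- The trace of a matrix power as a sum over closed walks. -/
theorem trace_pow_eq_sum_closed_walk {V : Type*} [Fintype V] [DecidableEq V] (M : Matrix V V ℝ)
    (L : ℕ) :
    (M ^ (L + 1)).trace = ∑ u : Fin (L + 1) → V, ∏ i, M (u i) (u (i + 1)) := by
  have h : (M ^ (L + 1)).trace = ∑ i, ∑ j, (M ^ L) i j * M j i := by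
    simp [Matrix.trace, pow_succ, Matrix.mul_apply]
  rw [h, sum_pow_mul_eq_sum_walk M L fun i j => M j i]
  refine Finset.sum_congr rfl fun u _ => ?_
  rw [Fin.prod_univ_castSucc]
  simp

end Trace

/-! ### Good walks and expected traces. -/

/-- A closed walk (a cyclic sequence of vertices) without loops, in which every edge is traversed
at least twice. -/
def IsGoodWalk {V : Type*} {L : ℕ} (u : Fin (L + 1) → V) : Prop :=
  (∀ i, u i ≠ u (i + 1)) ∧ ∀ i, ∃ j, j ≠ i ∧ s(u j, u (j + 1)) = s(u i, u (i + 1))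

/-- The number of traversals of the edge `e` by the closed walk `u`. -/
def traversals {n L : ℕ} (u : Fin (L + 1) → Fin n) (e : VertexPair n) : ℕ :=
  (Finset.univ.filter fun i => s(u i, u (i + 1)) = s(e.1.1, e.1.2)).card

theorem prod_symMatrix_walk {n L : ℕ} (a : VertexPair n → ℝ) (u : Fin (L + 1) → Fin n)
    (hu : ∀ i, u i ≠ u (i + 1)) :
    ∏ i, symMatrix a (u i) (u (i + 1)) = ∏ e, a e ^ traversals u e := by
  choose g hg using fun i => exists_vertexPair (hu i)
  have h1 : ∀ i, symMatrix a (u i) (u (i + 1)) = a (g i) := fun i => symMatrix_of_sym2_eq a (hg i)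
  simp only [h1]
  rw [← Finset.prod_fiberwise Finset.univ g]
  refine Finset.prod_congr rfl fun e _ => ?_
  have h2 : traversals u e = (Finset.univ.filter fun i => g i = e).card := by
    unfold traversals
    congr 1
    ext i
    simp only [Finset.mem_filter, Finset.mem_univ, true_and, hg i]
    exact ⟨vertexPair_ext, fun h => by rw [h]⟩
  rw [h2, ← Finset.prod_const]
  exact Finset.prod_congr rfl fun i hi => by rw [(Finset.mem_filter.mp hi).2]

open scoped Classical in
/-- The expected trace of a power of a random symmetric matrix with independent entries. -/
theorem integral_trace_pow_symMatrix {n : ℕ} {X : Type*} [MeasurableSpace X] [Finite X]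
    [MeasurableSingletonClass X] (μ : VertexPair n → Measure X) [∀ e, IsProbabilityMeasure (μ e)]
    (h : VertexPair n → X → ℝ) (L : ℕ) :
    ∫ ω, (symMatrix (fun e => h e (ω e)) ^ (L + 1)).trace ∂Measure.pi μ =
      ∑ u : Fin (L + 1) → Fin n, if ∀ i, u i ≠ u (i + 1) then
        ∏ e, ∫ x, h e x ^ traversals u e ∂μ e else 0 := by
  simp only [trace_pow_eq_sum_closed_walk]
  rw [integral_finsetSum _ fun _ _ => Integrable.of_finite]
  refine Finset.sum_congr rfl fun u _ => ?_
  split_ifs with hu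
  · simp only [prod_symMatrix_walk _ u hu]
    exact integral_fintype_prod_eq_prod (fun e x => h e x ^ traversals u e)
  · push Not at hu
    obtain ⟨i, hi⟩ := hu
    have : ∀ a : VertexPair n → ℝ, ∏ i, symMatrix a (u i) (u (i + 1)) = 0 := fun a =>
      Finset.prod_eq_zero (Finset.mem_univ i) (by rw [← hi, symMatrix_self])
    simp [this]

theorem traversals_ne_one {n L : ℕ} {u : Fin (L + 1) → Fin n} (hu : IsGoodWalk u)
    (e : VertexPair n) : traversals u e ≠ 1 := by
  intro h
  obtain ⟨i, hi⟩ := Finset.card_eq_one.mp h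
  have hmem : ∀ j, s(u j, u (j + 1)) = s(e.1.1, e.1.2) ↔ j = i := by
    intro j
    simpa using Finset.ext_iff.mp hi j
  obtain ⟨j, hji, hj⟩ := hu.2 i
  exact hji ((hmem j).mp (hj.trans ((hmem i).mpr rfl)))

theorem exists_traversals_eq_one {n L : ℕ} {u : Fin (L + 1) → Fin n} (h0 : ∀ i, u i ≠ u (i + 1))
    (hu : ¬ IsGoodWalk u) : ∃ e, traversals u e = 1 := by
  have : ¬ ∀ i, ∃ j, j ≠ i ∧ s(u j, u (j + 1)) = s(u i, u (i + 1)) := fun h => hu ⟨h0, h⟩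
  push Not at this
  obtain ⟨i, hi⟩ := this
  obtain ⟨e, he⟩ := exists_vertexPair (h0 i)
  refine ⟨e, Finset.card_eq_one.mpr ⟨i, ?_⟩⟩
  ext j
  simp only [Finset.mem_filter, Finset.mem_univ, true_and, Finset.mem_singleton]
  constructor
  · intro hj
    by_contra hji
    exact hi j hji (hj.trans he.symm)
  · rintro rfl; exact he

/-- The visited graph is connected: a vertex reached for the first time is reached along an edge not
traversed before. -/
theorem card_image_range_le {V : Type*} [DecidableEq V] (u : ℕ → V) (t : ℕ) :
    ((Finset.range (t + 1)).image u).card ≤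
      ((Finset.range t).image fun i => s(u i, u (i + 1))).card + 1 := by
  induction t with
  | zero => simp
  | succ t ih =>
    have e1 : (Finset.range (t + 1 + 1)).image u =
        insert (u (t + 1)) ((Finset.range (t + 1)).image u) := by
      rw [Finset.range_add_one (n := t + 1), Finset.image_insert]
    have e2 : (Finset.range (t + 1)).image (fun i => s(u i, u (i + 1))) =
        insert s(u t, u (t + 1)) ((Finset.range t).image fun i => s(u i, u (i + 1))) := by
      rw [Finset.range_add_one, Finset.image_insert]
    rw [e1, e2]
    by_cases h : u (t + 1) ∈ (Finset.range (t + 1)).image u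
    · rw [Finset.insert_eq_of_mem h]
      exact ih.trans (Nat.add_le_add_right (Finset.card_le_card (Finset.subset_insert _ _)) 1)
    · rw [Finset.card_insert_of_notMem h, Finset.card_insert_of_notMem]
      · omega
      · intro h'
        obtain ⟨i, hi, hi'⟩ := Finset.mem_image.mp h'
        have hi := Finset.mem_range.mp hi
        apply h
        rcases Sym2.eq_iff.mp hi' with ⟨-, h2⟩ | ⟨h1, -⟩
        · exact Finset.mem_image.mpr ⟨i + 1, by simp; omega, h2⟩
        · exact Finset.mem_image.mpr ⟨i, by simp; omega, h1⟩

theorem card_image_le_card_traversed {n L : ℕ} {u : Fin (L + 1) → Fin n}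
    (hu : ∀ i, u i ≠ u (i + 1)) :
    (Finset.univ.image u).card ≤ (Finset.univ.filter fun e => traversals u e ≠ 0).card + 1 := by
  -- The closing step of the cyclic walk is dropped: the first `L` steps already visit every vertex.
  have h1 := card_image_range_le (fun i : ℕ => u (Fin.ofNat (L + 1) i)) L
  have h2 : (Finset.range (L + 1)).image (fun i : ℕ => u (Fin.ofNat (L + 1) i)) =
      Finset.univ.image u := by
    ext v
    simp only [Finset.mem_image, Finset.mem_range, Finset.mem_univ, true_and]
    constructor
    · rintro ⟨i, -, rfl⟩; exact ⟨_, rfl⟩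
    · rintro ⟨i, rfl⟩; exact ⟨i, i.2, by simp⟩
  rw [h2] at h1
  refine h1.trans (Nat.add_le_add_right ?_ 1)
  rw [← Finset.card_image_of_injective (Finset.univ.filter fun e => traversals u e ≠ 0)
    (f := fun e : VertexPair n => s(e.1.1, e.1.2)) fun _ _ => vertexPair_ext]
  refine Finset.card_le_card fun z hz => ?_
  obtain ⟨i, -, rfl⟩ := Finset.mem_image.mp hz
  have hi : Fin.ofNat (L + 1) (i + 1) = Fin.ofNat (L + 1) i + 1 := by
    ext; simp [Fin.val_add]
  simp only [hi]
  obtain ⟨e, he⟩ := exists_vertexPair (hu (Fin.ofNat (L + 1) i))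
  refine Finset.mem_image.mpr ⟨e, ?_, he.symm⟩
  simp only [Finset.mem_filter, Finset.mem_univ, true_and]
  exact Finset.card_ne_zero_of_mem
    (Finset.mem_filter.mpr ⟨Finset.mem_univ (Fin.ofNat (L + 1) i), he⟩)

-- By independence the expectation of a walk factors over edges. An edge traversed once contributes
-- the mean, zero, which leaves the good walks; each edge of such a walk contributes at most `p`,
-- and there are at least as many edges as vertices minus one.
open scoped Classical in
theorem integral_trace_pow_le {n : ℕ} {X : Type*} [MeasurableSpace X] [Finite X]
    [MeasurableSingletonClass X] (μ : VertexPair n → Measure X) [∀ e, IsProbabilityMeasure (μ e)]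
    (h : VertexPair n → X → ℝ) {p : ℝ} (hp0 : 0 ≤ p) (hp1 : p ≤ 1) (h1 : ∀ e, ∫ x, h e x ∂μ e = 0)
    (h2 : ∀ e c, 2 ≤ c → |∫ x, h e x ^ c ∂μ e| ≤ p) (L : ℕ) :
    ∫ ω, (symMatrix (fun e => h e (ω e)) ^ (L + 1)).trace ∂Measure.pi μ ≤
      ∑ u : Fin (L + 1) → Fin n with IsGoodWalk u, p ^ ((Finset.univ.image u).card - 1) := by
  rw [integral_trace_pow_symMatrix, Finset.sum_filter]
  refine Finset.sum_le_sum fun u _ => ?_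
  by_cases hu : ∀ i, u i ≠ u (i + 1)
  · rw [if_pos hu]
    by_cases hg : IsGoodWalk u
    · rw [if_pos hg]
      calc ∏ e, ∫ x, h e x ^ traversals u e ∂μ e
          ≤ |∏ e, ∫ x, h e x ^ traversals u e ∂μ e| := le_abs_self _
        _ = ∏ e, |∫ x, h e x ^ traversals u e ∂μ e| := Finset.abs_prod _ _
        _ ≤ ∏ e, if traversals u e ≠ 0 then p else 1 := by
            refine Finset.prod_le_prod (fun _ _ => abs_nonneg _) fun e _ => ?_
            have := traversals_ne_one hg e
            split_ifs with h0
            · exact h2 e _ (by omega)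
            · push Not at h0
              simp [h0]
        _ = p ^ (Finset.univ.filter fun e => traversals u e ≠ 0).card := by
            rw [← Finset.prod_filter, Finset.prod_const]
        _ ≤ p ^ ((Finset.univ.image u).card - 1) := by
            refine pow_le_pow_of_le_one hp0 hp1 ?_
            have := card_image_le_card_traversed hu
            omega
    · obtain ⟨e, he⟩ := exists_traversals_eq_one hu hg
      rw [if_neg hg, Finset.prod_eq_zero (Finset.mem_univ e)]
      simp [he, h1]
  · rw [if_neg hu]
    split_ifs <;> positivity

-- The reverse use of the same expansion: if every factor of a good walk is at least one, the
-- expected trace counts good walks.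
open scoped Classical in
theorem card_isGoodWalk_le_integral {n : ℕ} {X : Type*} [MeasurableSpace X] [Finite X]
    [MeasurableSingletonClass X] (μ : VertexPair n → Measure X) [∀ e, IsProbabilityMeasure (μ e)]
    (h : VertexPair n → X → ℝ) (h1 : ∀ e, ∫ x, h e x ∂μ e = 0)
    (h2 : ∀ e c, 2 ≤ c → 1 ≤ ∫ x, h e x ^ c ∂μ e) (L : ℕ) :
    ((Finset.univ.filter fun u : Fin (L + 1) → Fin n => IsGoodWalk u).card : ℝ) ≤
    ∫ ω, (symMatrix (fun e => h e (ω e)) ^ (L + 1)).trace ∂Measure.pi μ := by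
  rw [integral_trace_pow_symMatrix, Finset.card_filter, Nat.cast_sum]
  refine Finset.sum_le_sum fun u _ => ?_
  by_cases hu : ∀ i, u i ≠ u (i + 1)
  · rw [if_pos hu]
    by_cases hg : IsGoodWalk u
    · rw [if_pos hg, Nat.cast_one]
      have : ∏ _e : VertexPair n, (1 : ℝ) ≤ ∏ e, ∫ x, h e x ^ traversals u e ∂μ e := by
        refine Finset.prod_le_prod (fun _ _ => zero_le_one) fun e _ => ?_
        have := traversals_ne_one hg e
        rcases Nat.eq_zero_or_pos (traversals u e) with h0 | h0
        · simp [h0]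
        · exact h2 e _ (by omega)
      simpa using this
    · obtain ⟨e, he⟩ := exists_traversals_eq_one hu hg
      rw [if_neg hg, Finset.prod_eq_zero (Finset.mem_univ e)]
      · simp
      · simp [he, h1]
  · rw [if_neg hu, if_neg fun hg : IsGoodWalk u => hu hg.1]
    simp

/-! ### Shapes of walks and comparison of vertex sets. -/

section Shape

variable {α β : Type*} {L : ℕ}

theorem IsGoodWalk.of_kernel_eq {u : Fin (L + 1) → α} {v : Fin (L + 1) → β}
    (h : ∀ i j, u i = u j ↔ v i = v j) (hu : IsGoodWalk u) : IsGoodWalk v := by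
  refine ⟨fun i hi => hu.1 i ((h _ _).mpr hi), fun i => ?_⟩
  obtain ⟨j, hji, hj⟩ := hu.2 i
  refine ⟨j, hji, ?_⟩
  rw [Sym2.eq_iff] at hj ⊢
  simpa only [← h] using hj

/-- The shape of a sequence: each entry is replaced by the position of its first occurrence. -/
def shape [DecidableEq α] (u : Fin L → α) (i : Fin L) : Fin L :=
  (Finset.univ.filter fun j => u j = u i).min' ⟨i, by simp⟩

variable [DecidableEq α] [DecidableEq β]

theorem apply_shape (u : Fin L → α) (i : Fin L) : u (shape u i) = u i := by
  have := Finset.min'_mem (Finset.univ.filter fun j => u j = u i) ⟨i, by simp⟩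
  exact (Finset.mem_filter.mp this).2

theorem shape_eq_iff (u : Fin L → α) (i j : Fin L) : shape u i = shape u j ↔ u i = u j := by
  constructor
  · intro h
    exact (apply_shape u i).symm.trans ((congrArg u h).trans (apply_shape u j))
  · intro h
    simp only [shape, h]

theorem shape_congr {u : Fin L → α} {v : Fin L → β} (h : ∀ i j, u i = u j ↔ v i = v j) :
    shape u = shape v := by
  funext i
  simp only [shape, h]

theorem shape_shape (u : Fin L → α) : shape (shape u) = shape u :=
  shape_congr fun i j => shape_eq_iff u i j

theorem card_image_shape (u : Fin L → α) :
    (Finset.univ.image (shape u)).card = (Finset.univ.image u).card := by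
  have h : Finset.univ.image u = (Finset.univ.image (shape u)).image u := by
    rw [Finset.image_image]
    exact Finset.image_congr fun i _ => (apply_shape u i).symm
  refine (Eq.trans (congrArg Finset.card h) (Finset.card_image_of_injOn ?_)).symm
  intro x hx y hy hxy
  obtain ⟨i, -, rfl⟩ := Finset.mem_image.mp (Finset.mem_coe.mp hx)
  obtain ⟨j, -, rfl⟩ := Finset.mem_image.mp (Finset.mem_coe.mp hy)
  rw [apply_shape u i, apply_shape u j] at hxy
  exact (shape_eq_iff u i j).mpr hxy

/-- Once the shape is fixed, the values at first occurrences determine the sequence. -/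
theorem card_shape_eq_le (n : ℕ) (κ : Fin L → Fin L) :
    (Finset.univ.filter fun u : Fin L → Fin n => shape u = κ).card ≤
      n ^ (Finset.univ.image κ).card := by
  have h := Finset.card_le_card_of_injOn
    (s := Finset.univ.filter fun u : Fin L → Fin n => shape u = κ)
    (t := (Finset.univ : Finset ((Finset.univ.image κ) → Fin n))) (fun u x => u x.1)
    (fun _ _ => Finset.mem_coe.mpr (Finset.mem_univ _)) ?_
  · rwa [Finset.card_univ, Fintype.card_fun, Fintype.card_fin, Fintype.card_coe] at h
  · intro u hu v hv huv
    have hu : shape u = κ := by simpa using hu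
    have hv : shape v = κ := by simpa using hv
    funext i
    rw [← apply_shape u i, ← apply_shape v i, hu, hv]
    exact congrFun huv ⟨κ i, Finset.mem_image_of_mem κ (Finset.mem_univ i)⟩

/-- Distinct values placed at the first occurrences produce a sequence of exactly this shape. -/
theorem descFactorial_le_card_shape_eq (r : ℕ) {κ : Fin L → Fin L} (hκ : shape κ = κ) :
    r.descFactorial (Finset.univ.image κ).card ≤
      (Finset.univ.filter fun u : Fin L → Fin r => shape u = κ).card := by
  have hmem : ∀ i, κ i ∈ Finset.univ.image κ := fun i =>
    Finset.mem_image_of_mem κ (Finset.mem_univ i)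
  have h := Finset.card_le_card_of_injOn
    (s := (Finset.univ : Finset ((Finset.univ.image κ) ↪ Fin r)))
    (t := Finset.univ.filter fun u : Fin L → Fin r => shape u = κ)
    (fun f i => f ⟨κ i, hmem i⟩) ?_ ?_
  · rwa [Finset.card_univ, Fintype.card_embedding_eq, Fintype.card_fin, Fintype.card_coe] at h
  · intro f _
    simp only [Finset.coe_filter, Finset.mem_univ, true_and, Set.mem_ofPred_eq]
    refine (shape_congr fun i j => ?_).trans hκ
    simp
  · intro f _ g _ hfg
    ext ⟨x, hx⟩
    obtain ⟨i, -, rfl⟩ := Finset.mem_image.mp hx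
    exact congrArg Fin.val (congrFun hfg i)

open scoped Classical in
/-- Comparison of weighted closed walks in a large vertex set with closed walks in a small one. -/
theorem sum_isGoodWalk_le {n r : ℕ} {p : ℝ} (hp : 0 ≤ p)
    (hr : n * p + (L + 1 : ℕ) ≤ r) :
    r * ∑ u : Fin (L + 1) → Fin n with IsGoodWalk u, p ^ ((Finset.univ.image u).card - 1) ≤
      n * ((Finset.univ.filter fun u : Fin (L + 1) → Fin r => IsGoodWalk u).card : ℝ) := by
  rw [← Finset.sum_fiberwise (Finset.univ.filter _) (fun u => shape u),
    Finset.card_eq_sum_card_fiberwise (f := fun u => shape u) (t := Finset.univ) (by simp),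
    Finset.mul_sum, Nat.cast_sum, Finset.mul_sum]
  refine Finset.sum_le_sum fun κ _ => ?_
  simp only [Finset.filter_filter]
  by_cases hex : ∃ u : Fin (L + 1) → Fin n, IsGoodWalk u ∧ shape u = κ
  · obtain ⟨u₀, hu₀, rfl⟩ := hex
    set κ := shape u₀ with hκdef
    have hκ : shape κ = κ := shape_shape u₀
    have hgood : IsGoodWalk κ := hu₀.of_kernel_eq fun i j => (shape_eq_iff u₀ i j).symm
    set t := (Finset.univ.image κ).card with ht
    have ht0 : 1 ≤ t := Finset.card_pos.mpr ⟨κ 0, by simp⟩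
    have htL : t ≤ L + 1 := by simpa using Finset.card_image_le (s := Finset.univ) (f := κ)
    clear_value t
    obtain ⟨t', rfl⟩ : ∃ t', t = t' + 1 := ⟨t - 1, by omega⟩
    have hLr : L + 1 ≤ r := by
      have : ((L + 1 : ℕ) : ℝ) ≤ r := le_trans (by simpa using by positivity) hr
      exact_mod_cast this
    have h1 : ∑ u : Fin (L + 1) → Fin n with IsGoodWalk u ∧ shape u = κ,
        p ^ ((Finset.univ.image u).card - 1) ≤ n ^ (t' + 1) * p ^ t' := by
      calc _ ≤ ∑ u : Fin (L + 1) → Fin n with shape u = κ, p ^ t' := by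
            rw [Finset.sum_congr rfl (g := fun _ => p ^ t')]
            · exact Finset.sum_le_sum_of_subset_of_nonneg
                (fun u hu => by simp at hu ⊢; exact hu.2) fun _ _ _ => by positivity
            · intro u hu
              have hu : shape u = κ := (Finset.mem_filter.mp hu).2.2
              rw [← card_image_shape, hu, ← ht, Nat.add_sub_cancel]
        _ ≤ _ := by
            rw [Finset.sum_const, nsmul_eq_mul]
            refine mul_le_mul_of_nonneg_right ?_ (by positivity)
            have := card_shape_eq_le n κ
            rw [← ht] at this
            exact_mod_cast this
    have h2 : (r : ℝ) * (n * p) ^ t' ≤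
        ((Finset.univ.filter fun u : Fin (L + 1) → Fin r =>
          IsGoodWalk u ∧ shape u = κ).card : ℝ) := by
      have e1 : (Finset.univ.filter fun u : Fin (L + 1) → Fin r => shape u = κ) =
          Finset.univ.filter fun u : Fin (L + 1) → Fin r => IsGoodWalk u ∧ shape u = κ := by
        refine Finset.filter_congr fun u _ => ⟨fun h => ⟨?_, h⟩, fun h => h.2⟩
        exact hgood.of_kernel_eq fun i j => by rw [← h, shape_eq_iff]
      rw [← e1]
      have e2 := descFactorial_le_card_shape_eq r hκ
      rw [← ht] at e2
      obtain ⟨r', rfl⟩ : ∃ r', r = r' + 1 := ⟨r - 1, by omega⟩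
      -- One factor `r` is split off and the other `t'` factors are each at least `r - t'`. Since
      -- `t' ≤ L`, the hypothesis on `r` makes `r - t'` at least `n p`.
      rw [Nat.succ_descFactorial_succ] at e2
      have e3 := Nat.pow_sub_le_descFactorial r' t'
      have e4 : ((r' + 1 : ℕ) : ℝ) * ((r' + 1 - t' : ℕ) : ℝ) ^ t' ≤
          ((Finset.univ.filter fun u : Fin (L + 1) → Fin (r' + 1) => shape u = κ).card : ℝ) := by
        exact_mod_cast (Nat.mul_le_mul_left _ e3).trans e2
      refine le_trans ?_ e4
      gcongr
      rw [Nat.cast_sub (by omega)]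
      have : ((t' + 1 : ℕ) : ℝ) ≤ ((L + 1 : ℕ) : ℝ) := by exact_mod_cast htL
      push_cast at this hr ⊢
      linarith
    calc (r : ℝ) * _ ≤ r * (n ^ (t' + 1) * p ^ t') := by gcongr
      _ = n * (r * (n * p) ^ t') := by rw [mul_pow]; ring
      _ ≤ _ := by gcongr
  · push Not at hex
    rw [Finset.filter_false_of_mem fun u _ h => hex u h.1 h.2]
    simp only [Finset.sum_empty, mul_zero]
    positivity

end Shape

/-! ### Quadratic forms and their subgaussian moments. -/

section Quadratic

theorem sum_vertexPair {n : ℕ} (g : Fin n → Fin n → ℝ) :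
    ∑ e : VertexPair n, g e.1.1 e.1.2 = ∑ i, ∑ j, if i < j then g i j else 0 := by
  rw [← Finset.sum_product', Finset.univ_product_univ,
    ← Finset.sum_filter (fun x : Fin n × Fin n => x.1 < x.2) (fun x => g x.1 x.2)]
  exact (Finset.sum_subtype _ (by simp) fun x : Fin n × Fin n => g x.1 x.2).symm

open Matrix in
theorem dotProduct_symMatrix_mulVec {n : ℕ} (a : VertexPair n → ℝ) (x : Fin n → ℝ) :
    x ⬝ᵥ (symMatrix a *ᵥ x) = ∑ e : VertexPair n, 2 * (x e.1.1 * x e.1.2) * a e := by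
  have h : ∑ e : VertexPair n, 2 * (x e.1.1 * x e.1.2) * a e =
      2 * ∑ e : VertexPair n, x e.1.1 * (symMatrix a e.1.1 e.1.2 * x e.1.2) := by
    rw [Finset.mul_sum]
    refine Finset.sum_congr rfl fun e _ => ?_
    rw [symMatrix_of_sym2_eq a (e := e) rfl]; ring
  rw [h, sum_vertexPair fun i j => x i * (symMatrix a i j * x j), two_mul]
  nth_rw 2 [Finset.sum_comm]
  simp only [dotProduct, mulVec, Finset.mul_sum, ← Finset.sum_add_distrib]
  refine Finset.sum_congr rfl fun i _ => Finset.sum_congr rfl fun j _ => ?_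
  have hs : symMatrix a j i = symMatrix a i j := by
    simpa using (symMatrix_isHermitian a).apply i j
  rcases lt_trichotomy i j with h | rfl | h
  · simp [h, h.not_gt]
  · simp [symMatrix_self]
  · simp [h, h.not_gt, hs]; ring

theorem sum_vertexPair_sq_le {n : ℕ} (x : Fin n → ℝ) :
    ∑ e : VertexPair n, (x e.1.1 * x e.1.2) ^ 2 ≤ (∑ i, x i ^ 2) ^ 2 := by
  rw [sum_vertexPair fun i j => (x i * x j) ^ 2, sq (∑ i, x i ^ 2), Finset.sum_mul_sum]
  refine Finset.sum_le_sum fun i _ => Finset.sum_le_sum fun j _ => ?_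
  split_ifs
  · rw [mul_pow]
  · positivity

end Quadratic

section Subgaussian

variable {X : Type*} [MeasurableSpace X] [Finite X] [MeasurableSingletonClass X]

/-- Hoeffding's lemma on `[-2, 2]`: variance proxy `4`, hence exponent `4 t² / 2`. -/
theorem integral_exp_mul_le {ν : Measure X} [IsProbabilityMeasure ν] {h : X → ℝ}
    (hb : ∀ x, |h x| ≤ 2) (h0 : ∫ x, h x ∂ν = 0) (t : ℝ) :
    ∫ x, Real.exp (t * h x) ∂ν ≤ Real.exp (2 * t ^ 2) := by
  have := (hasSubgaussianMGF_of_mem_Icc_of_integral_eq_zero (μ := ν) (X := h) (a := -2) (b := 2)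
    (measurable_of_finite h).aemeasurable (ae_of_all _ fun x => abs_le.mp (hb x)) h0).mgf_le t
  refine this.trans (le_of_eq ?_)
  congr 1
  norm_num
  ring

open Matrix in
theorem integral_exp_quadratic_le {n : ℕ} {ν : Measure X} [IsProbabilityMeasure ν] {h : X → ℝ}
    (hb : ∀ x, |h x| ≤ 2) (h0 : ∫ x, h x ∂ν = 0) (x : Fin n → ℝ) (t : ℝ) :
    ∫ ω, Real.exp (t * (x ⬝ᵥ (symMatrix (fun e => h (ω e)) *ᵥ x)))
      ∂Measure.pi (fun _ : VertexPair n => ν) ≤ Real.exp (8 * t ^ 2 * (∑ i, x i ^ 2) ^ 2) := by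
  have e1 : ∀ ω : VertexPair n → X, Real.exp (t * (x ⬝ᵥ (symMatrix (fun e => h (ω e)) *ᵥ x))) =
      ∏ e : VertexPair n, Real.exp (t * (2 * (x e.1.1 * x e.1.2)) * h (ω e)) := by
    intro ω
    rw [dotProduct_symMatrix_mulVec, Finset.mul_sum, Real.exp_sum]
    exact Finset.prod_congr rfl fun e _ => by ring_nf
  simp only [e1]
  rw [integral_fintype_prod_eq_prod
    (fun (e : VertexPair n) y => Real.exp (t * (2 * (x e.1.1 * x e.1.2)) * h y))]
  calc _ ≤ ∏ e : VertexPair n, Real.exp (2 * (t * (2 * (x e.1.1 * x e.1.2))) ^ 2) :=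
        Finset.prod_le_prod (fun _ _ => integral_nonneg fun _ => (Real.exp_pos _).le)
          fun e _ => integral_exp_mul_le hb h0 _
    _ = Real.exp (8 * t ^ 2 * ∑ e : VertexPair n, (x e.1.1 * x e.1.2) ^ 2) := by
        rw [← Real.exp_sum, Finset.mul_sum]
        congr 1
        exact Finset.sum_congr rfl fun e _ => by ring
    _ ≤ _ := by
        gcongr
        exact sum_vertexPair_sq_le x

theorem pow_le_factorial_mul_exp_add_exp (y : ℝ) (m : ℕ) :
    y ^ (2 * m) ≤ (2 * m).factorial * (Real.exp y + Real.exp (-y)) := by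
  have h1 := Real.pow_div_factorial_le_exp |y| (abs_nonneg y) (2 * m)
  rw [(even_two_mul m).pow_abs, div_le_iff₀ (by positivity), mul_comm (Real.exp _)] at h1
  refine h1.trans (mul_le_mul_of_nonneg_left ?_ (by positivity))
  rcases abs_cases y with ⟨h, -⟩ | ⟨h, -⟩ <;> rw [h]
  · linarith [Real.exp_pos (-y)]
  · linarith [Real.exp_pos y]

-- An even power is bounded by the matching term of the exponential series, whose expectation is
-- subgaussian. The parameter `t` stays free, to be taken as `1/√r`.
open Matrix in
theorem integral_quadratic_pow_le {n : ℕ} {ν : Measure X} [IsProbabilityMeasure ν] {h : X → ℝ}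
    (hb : ∀ x, |h x| ≤ 2) (h0 : ∫ x, h x ∂ν = 0) (x : Fin n → ℝ) {t : ℝ} (ht : 0 < t) (m : ℕ) :
    ∫ ω, (x ⬝ᵥ (symMatrix (fun e => h (ω e)) *ᵥ x)) ^ (2 * m)
      ∂Measure.pi (fun _ : VertexPair n => ν) ≤
      (2 * m).factorial * (2 * Real.exp (8 * t ^ 2 * (∑ i, x i ^ 2) ^ 2)) / t ^ (2 * m) := by
  rw [le_div_iff₀ (by positivity), ← integral_mul_const]
  set Q : (VertexPair n → X) → ℝ := fun ω => x ⬝ᵥ (symMatrix (fun e => h (ω e)) *ᵥ x)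
  have h1 := integral_exp_quadratic_le hb h0 x t
  have h2 := integral_exp_quadratic_le hb h0 x (-t)
  calc _ ≤ ∫ ω, (2 * m).factorial * (Real.exp (t * Q ω) + Real.exp (-t * Q ω))
          ∂Measure.pi (fun _ : VertexPair n => ν) := by
        refine integral_mono Integrable.of_finite Integrable.of_finite fun ω => ?_
        have := pow_le_factorial_mul_exp_add_exp (t * Q ω) m
        rw [mul_pow, mul_comm] at this
        simpa only [neg_mul] using this
    _ ≤ _ := by
        rw [integral_const_mul, integral_add Integrable.of_finite Integrable.of_finite]
        rw [neg_sq] at h2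
        refine mul_le_mul_of_nonneg_left ?_ (by positivity)
        linarith

end Subgaussian

/-! ### A lattice net for the operator norm. -/

section Net

theorem sum_half_pow_natAbs_le (K : ℕ) :
    ∑ z ∈ Finset.Icc (-(K : ℤ)) K, (1 / 2 : ℝ) ^ z.natAbs ≤ 3 := by
  have : ∑ z ∈ Finset.Icc (-(K : ℤ)) K, (1 / 2 : ℝ) ^ z.natAbs = 3 - 2 * (1 / 2) ^ K := by
    induction K with
    | zero => norm_num
    | succ K ih =>
      have h : Finset.Icc (-((K + 1 : ℕ) : ℤ)) ((K + 1 : ℕ) : ℤ) =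
          insert (-((K + 1 : ℕ) : ℤ)) (insert ((K + 1 : ℕ) : ℤ) (Finset.Icc (-(K : ℤ)) K)) := by
        ext z
        simp only [Finset.mem_Icc, Finset.mem_insert]
        omega
      rw [h, Finset.sum_insert (by simp; omega), Finset.sum_insert (by simp), ih, Int.natAbs_neg,
        Int.natAbs_natCast, pow_succ]
      ring
  rw [this]
  linarith [show (0 : ℝ) < (1 / 2) ^ K by positivity]

/-- Lattice points of squared norm at most `7 r` in dimension `r`. -/
noncomputable def latticeNet (r : ℕ) : Finset (Fin r → ℤ) :=
  (Fintype.piFinset fun _ => Finset.Icc (-((7 * r : ℕ) : ℤ)) ((7 * r : ℕ) : ℤ)).filter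
    fun z => ∑ i, z i ^ 2 ≤ 7 * r

theorem mem_latticeNet {r : ℕ} {z : Fin r → ℤ} :
    z ∈ latticeNet r ↔ ∑ i, z i ^ 2 ≤ 7 * r := by
  refine ⟨fun h => (Finset.mem_filter.mp h).2, fun h => Finset.mem_filter.mpr ⟨?_, h⟩⟩
  rw [Fintype.mem_piFinset]
  intro i
  have h1 : z i ^ 2 ≤ 7 * r :=
    (Finset.single_le_sum (f := fun i => z i ^ 2) (fun i _ => sq_nonneg _)
      (Finset.mem_univ i)).trans h
  rw [Finset.mem_Icc]
  push_cast
  constructor <;> nlinarith [Int.le_self_sq (z i), Int.le_self_sq (-z i)]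

theorem card_latticeNet_le (r : ℕ) : ((latticeNet r).card : ℝ) ≤ 384 ^ r := by
  calc ((latticeNet r).card : ℝ) = ∑ z ∈ latticeNet r, (1 : ℝ) := by simp
    -- Each net point has `∑ |z i| ≤ ∑ (z i)² ≤ 7 r`, so its weight is at least one. The weights
    -- factor over coordinates, and the total is at most `(2^7 · 3)^r = 384^r`.
    _ ≤ ∑ z ∈ latticeNet r, 2 ^ (7 * r) * ∏ i, (1 / 2 : ℝ) ^ (z i).natAbs := by
        refine Finset.sum_le_sum fun z hz => ?_
        have h1 : ∑ i, (z i).natAbs ≤ 7 * r := by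
          have h2 := mem_latticeNet.mp hz
          have h3 : ∑ i, ((z i).natAbs : ℤ) ≤ ∑ i, z i ^ 2 := by
            refine Finset.sum_le_sum fun i _ => ?_
            rw [← Int.natAbs_sq]
            exact Int.le_self_sq _
          have h4 := h3.trans h2
          exact_mod_cast h4
        rw [Finset.prod_pow_eq_pow_sum]
        calc (1 : ℝ) = 2 ^ (7 * r) * (1 / 2) ^ (7 * r) := by rw [← mul_pow]; norm_num
          _ ≤ _ := mul_le_mul_of_nonneg_left
              (pow_le_pow_of_le_one (by norm_num) (by norm_num) h1) (by positivity)
    _ ≤ ∑ z ∈ Fintype.piFinset fun _ : Fin r =>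
          Finset.Icc (-((7 * r : ℕ) : ℤ)) ((7 * r : ℕ) : ℤ),
          2 ^ (7 * r) * ∏ i, (1 / 2 : ℝ) ^ (z i).natAbs :=
        Finset.sum_le_sum_of_subset_of_nonneg (Finset.filter_subset _ _)
          fun _ _ _ => by positivity
    _ = 2 ^ (7 * r) * ∏ _i : Fin r, ∑ z ∈ Finset.Icc (-((7 * r : ℕ) : ℤ)) ((7 * r : ℕ) : ℤ),
          (1 / 2 : ℝ) ^ z.natAbs := by
        rw [← Finset.mul_sum, Finset.prod_univ_sum]
    _ ≤ 2 ^ (7 * r) * ∏ _i : Fin r, 3 := by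
        refine mul_le_mul_of_nonneg_left ?_ (by positivity)
        exact Finset.prod_le_prod (fun _ _ => Finset.sum_nonneg fun _ _ => by positivity)
          fun _ _ => sum_half_pow_natAbs_le _
    _ = 384 ^ r := by
        rw [Finset.prod_const, Finset.card_univ, Fintype.card_fin, pow_mul, ← mul_pow]
        norm_num

-- The net point is a rounded multiple of a unit eigenvector `v` whose eigenvalue `l` is largest in
-- modulus. The cross terms with the rounding error `d` are again multiples of `l`, and the form at
-- `d` is at most `|l| |d|²`, so rounding cannot cancel the main term.
open Matrix in
theorem Matrix.IsHermitian.exists_latticeNet {r : ℕ} (hr : 0 < r) {M : Matrix (Fin r) (Fin r) ℝ}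
    (hM : M.IsHermitian) : ∃ z ∈ latticeNet r, ∀ i,
      r * |hM.eigenvalues i| ≤ |(fun i => (z i : ℝ)) ⬝ᵥ (M *ᵥ fun i => (z i : ℝ))| := by
  have : Nonempty (Fin r) := ⟨⟨0, hr⟩⟩
  obtain ⟨i₀, hi₀⟩ := Finite.exists_max fun i => |hM.eigenvalues i|
  set v : Fin r → ℝ := (hM.eigenvectorBasis i₀).ofLp with hvdef
  set l := hM.eigenvalues i₀ with hl
  have hMv : M *ᵥ v = l • v := hM.mulVec_eigenvectorBasis i₀
  have hvv : v ⬝ᵥ v = 1 := by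
    have h1 := hM.eigenvectorBasis.orthonormal.1 i₀
    have h2 := EuclideanSpace.real_norm_sq_eq (hM.eigenvectorBasis i₀)
    rw [h1] at h2
    simp only [dotProduct, ← sq]
    rw [← h2]; norm_num
  -- At this scale `|s v|² = 4 r`, while rounding changes the vector by squared norm at most `r /
  -- 4`.
  set s : ℝ := 2 * √r with hs
  have hs2 : s ^ 2 = 4 * r := by
    rw [hs, mul_pow, Real.sq_sqrt (by positivity)]; norm_num
  let z : Fin r → ℤ := fun i => round (s * v i)
  let d : Fin r → ℝ := fun i => z i - s * v i
  have hz : (fun i => (z i : ℝ)) = s • v + d := by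
    funext i; simp [d]
  have hdd : d ⬝ᵥ d ≤ r / 4 := by
    have h1 : ∀ i, d i * d i ≤ 1 / 4 := by
      intro i
      have h2 : |d i| ≤ 1 / 2 := by
        rw [abs_sub_comm]; exact abs_sub_round _
      rw [← abs_mul_abs_self]
      nlinarith [abs_nonneg (d i)]
    calc d ⬝ᵥ d ≤ ∑ _i : Fin r, (1 / 4 : ℝ) := Finset.sum_le_sum fun i _ => h1 i
      _ = r / 4 := by simp; ring
  have hd0 : 0 ≤ d ⬝ᵥ d := by simpa using dotProduct_star_self_nonneg d
  have hdv : d ⬝ᵥ v = v ⬝ᵥ d := dotProduct_comm _ _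
  -- These two squares give `|2 s (v · d)| ≤ s²/2 + 2 |d|² ≤ 5r/2`. Hence `|z|² ≤ 27r/4 ≤ 7r`, and
  -- the form at `z` is at least `(3/2 - 1/4) r |l|` in absolute value.
  have h1 : 0 ≤ (s • v + (2 : ℝ) • d) ⬝ᵥ (s • v + (2 : ℝ) • d) := by
    simpa using dotProduct_star_self_nonneg (s • v + (2 : ℝ) • d)
  have h2 : 0 ≤ (s • v - (2 : ℝ) • d) ⬝ᵥ (s • v - (2 : ℝ) • d) := by
    simpa using dotProduct_star_self_nonneg (s • v - (2 : ℝ) • d)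
  simp only [dotProduct_add, add_dotProduct, dotProduct_sub, sub_dotProduct, dotProduct_smul,
    smul_dotProduct, smul_eq_mul, hvv, hdv] at h1 h2
  have hzz : (fun i => (z i : ℝ)) ⬝ᵥ (fun i => (z i : ℝ)) = s ^ 2 + 2 * s * (v ⬝ᵥ d) + d ⬝ᵥ d := by
    rw [hz]
    simp only [dotProduct_add, add_dotProduct, dotProduct_smul, smul_dotProduct, smul_eq_mul, hvv,
      hdv]
    ring
  have hzM : (fun i => (z i : ℝ)) ⬝ᵥ (M *ᵥ fun i => (z i : ℝ)) =
      l * (s ^ 2 + 2 * s * (v ⬝ᵥ d)) + d ⬝ᵥ (M *ᵥ d) := by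
    have hMt : M.IsSymm := by simpa using hM
    have hvM : v ⬝ᵥ (M *ᵥ d) = l * (v ⬝ᵥ d) := by
      rw [dotProduct_mulVec, ← mulVec_transpose, hMt.eq, hMv, smul_dotProduct, smul_eq_mul]
    rw [hz]
    simp only [mulVec_add, mulVec_smul, hMv, dotProduct_add, add_dotProduct, dotProduct_smul,
      smul_dotProduct, smul_eq_mul, hvv, hdv, hvM]
    ring
  refine ⟨z, ?_, fun i => ?_⟩
  · rw [mem_latticeNet]
    have : (∑ i, (z i : ℝ) ^ 2) ≤ 7 * r := by
      have e : ∑ i, (z i : ℝ) ^ 2 = (fun i => (z i : ℝ)) ⬝ᵥ (fun i => (z i : ℝ)) := by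
        simp [dotProduct, sq]
      rw [e, hzz]
      have : (0 : ℝ) < r := by exact_mod_cast hr
      nlinarith
    exact_mod_cast this
  · have hq := hM.abs_quadratic_le hi₀ d
    have hr' : (0 : ℝ) < r := by exact_mod_cast hr
    have e1 : 3 / 2 * r ≤ s ^ 2 + 2 * s * (v ⬝ᵥ d) := by nlinarith
    have e2 : |l| * (3 / 2 * r) ≤ |l * (s ^ 2 + 2 * s * (v ⬝ᵥ d))| := by
      rw [abs_mul]
      exact mul_le_mul_of_nonneg_left (e1.trans (le_abs_self _)) (abs_nonneg l)
    have e3 : |d ⬝ᵥ (M *ᵥ d)| ≤ |l| * (r / 4) :=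
      hq.trans (mul_le_mul_of_nonneg_left hdd (abs_nonneg l))
    have e4 := abs_sub_abs_le_abs_add (l * (s ^ 2 + 2 * s * (v ⬝ᵥ d))) (d ⬝ᵥ (M *ᵥ d))
    rw [hzM]
    have e5 : r * |hM.eigenvalues i| ≤ r * |l| := mul_le_mul_of_nonneg_left (hi₀ i) hr'.le
    have e6 : 0 ≤ |l| * r := by positivity
    nlinarith

open Matrix in
theorem Matrix.IsHermitian.trace_pow_le_sum_latticeNet {r : ℕ} (hr : 0 < r)
    {M : Matrix (Fin r) (Fin r) ℝ} (hM : M.IsHermitian) (m : ℕ) :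
    (M ^ (2 * m)).trace ≤ r * ∑ z ∈ latticeNet r,
      ((fun i => (z i : ℝ)) ⬝ᵥ (M *ᵥ fun i => (z i : ℝ))) ^ (2 * m) / r ^ (2 * m) := by
  obtain ⟨z, hz, h⟩ := hM.exists_latticeNet hr
  have hr' : (0 : ℝ) < r := by exact_mod_cast hr
  set Q : (Fin r → ℤ) → ℝ := fun z => (fun i => (z i : ℝ)) ⬝ᵥ (M *ᵥ fun i => (z i : ℝ)) with hQ
  have hnn : ∀ z, 0 ≤ Q z ^ (2 * m) / (r : ℝ) ^ (2 * m) := fun z =>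
    div_nonneg ((even_two_mul m).pow_nonneg _) (by positivity)
  have h1 : ∀ i, hM.eigenvalues i ^ (2 * m) ≤ Q z ^ (2 * m) / r ^ (2 * m) := by
    intro i
    rw [le_div_iff₀ (by positivity), ← (even_two_mul m).pow_abs, ← (even_two_mul m).pow_abs (Q z),
      ← mul_pow, mul_comm]
    exact pow_le_pow_left₀ (by positivity) (h i) _
  rw [hM.trace_pow]
  calc _ ≤ ∑ _i : Fin r, Q z ^ (2 * m) / r ^ (2 * m) := Finset.sum_le_sum fun i _ => h1 i
    _ = r * (Q z ^ (2 * m) / r ^ (2 * m)) := by simp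
    _ ≤ _ := mul_le_mul_of_nonneg_left
        (Finset.single_le_sum (f := fun z => Q z ^ (2 * m) / (r : ℝ) ^ (2 * m))
          (fun z _ => hnn z) hz) hr'.le

end Net

/-! ### Moments of dense matrices and the count of good walks. -/

/-- The maximum over the net is bounded by the sum. For a net point and `t = 1/√r`, the exponent is
at most `8 (7r)² / r = 392 r`, the factor `(2m)! ≤ r^(2m)` cancels the normalization, and `t^(-2m) =
r^m` remains. -/
theorem integral_trace_pow_le_of_bounded {X : Type*} [MeasurableSpace X] [Finite X]
    [MeasurableSingletonClass X] {ν : Measure X} [IsProbabilityMeasure ν] {h : X → ℝ}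
    (hb : ∀ x, |h x| ≤ 2) (h0 : ∫ x, h x ∂ν = 0) {r m : ℕ} (hr : 0 < r) (hmr : 2 * m ≤ r) :
    ∫ ω, (symMatrix (fun e => h (ω e)) ^ (2 * m)).trace
      ∂Measure.pi (fun _ : VertexPair r => ν) ≤ r ^ (m + 1) * (768 * Real.exp 392) ^ r := by
  have hr' : (0 : ℝ) < r := by exact_mod_cast hr
  have hbound : ∀ z ∈ latticeNet r,
      ∫ ω, ((fun i => (z i : ℝ)) ⬝ᵥ (Matrix.mulVec (symMatrix fun e => h (ω e))
        fun i => (z i : ℝ))) ^ (2 * m) / (r : ℝ) ^ (2 * m)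
        ∂Measure.pi (fun _ : VertexPair r => ν) ≤ r ^ m * (2 * Real.exp 392 ^ r) := by
    intro z hz
    have hz2 : ∑ i, (z i : ℝ) ^ 2 ≤ 7 * r := by exact_mod_cast mem_latticeNet.mp hz
    have h1 := integral_quadratic_pow_le hb h0 (fun i => (z i : ℝ)) (t := (√(r : ℝ))⁻¹)
      (by positivity) m
    rw [integral_div, div_le_iff₀ (by positivity)]
    refine h1.trans ?_
    have ht : (√(r : ℝ))⁻¹ ^ 2 = (r : ℝ)⁻¹ := by rw [inv_pow, Real.sq_sqrt hr'.le]
    have e1 : (((2 * m).factorial : ℕ) : ℝ) ≤ r ^ (2 * m) := by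
      have := (Nat.factorial_le_pow (2 * m)).trans (Nat.pow_le_pow_left hmr (2 * m))
      exact_mod_cast this
    have e2 : Real.exp (8 * (√(r : ℝ))⁻¹ ^ 2 * (∑ i, (z i : ℝ) ^ 2) ^ 2) ≤ Real.exp 392 ^ r := by
      rw [← Real.exp_nat_mul, ht]
      apply Real.exp_le_exp.mpr
      have : (∑ i, (z i : ℝ) ^ 2) ^ 2 ≤ (7 * r) ^ 2 :=
        pow_le_pow_left₀ (Finset.sum_nonneg fun _ _ => sq_nonneg _) hz2 2
      calc 8 * (r : ℝ)⁻¹ * (∑ i, (z i : ℝ) ^ 2) ^ 2 ≤ 8 * (r : ℝ)⁻¹ * (7 * r) ^ 2 := by gcongr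
        _ = (r : ℝ) * 392 := by field_simp; norm_num
    rw [pow_mul (√(r : ℝ))⁻¹]
    refine (div_le_div_of_nonneg_right (mul_le_mul_of_nonneg_left
      (mul_le_mul_of_nonneg_left e2 zero_le_two) (by positivity)) (by positivity)).trans ?_
    rw [ht, inv_pow, div_inv_eq_mul]
    calc _ ≤ (r : ℝ) ^ (2 * m) * (2 * Real.exp 392 ^ r) * r ^ m := by gcongr
      _ = _ := by ring
  calc _ ≤ ∫ ω, r * ∑ z ∈ latticeNet r,
        ((fun i => (z i : ℝ)) ⬝ᵥ (Matrix.mulVec (symMatrix fun e => h (ω e))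
          fun i => (z i : ℝ))) ^ (2 * m) / (r : ℝ) ^ (2 * m)
        ∂Measure.pi (fun _ : VertexPair r => ν) :=
      integral_mono Integrable.of_finite Integrable.of_finite fun ω =>
        (symMatrix_isHermitian _).trace_pow_le_sum_latticeNet hr m
    _ ≤ r * ∑ z ∈ latticeNet r, (r : ℝ) ^ m * (2 * Real.exp 392 ^ r) := by
      rw [integral_const_mul, integral_finsetSum _ fun _ _ => Integrable.of_finite]
      exact mul_le_mul_of_nonneg_left (Finset.sum_le_sum hbound) hr'.le
    _ ≤ r * (384 ^ r * (r ^ m * (2 ^ r * Real.exp 392 ^ r))) := by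
      rw [Finset.sum_const, nsmul_eq_mul]
      gcongr
      · exact card_latticeNet_le r
      · exact le_self_pow₀ (by norm_num) (by omega)
    _ = _ := by
      rw [show (768 : ℝ) = 384 * 2 by norm_num, mul_pow, mul_pow]
      ring

/-- The base of the exponential factor in the moment bound for random symmetric matrices. -/
noncomputable def momentBase : ℝ := 768 * Real.exp 392

theorem momentBase_pos : 0 < momentBase := by unfold momentBase; positivity

/-- The number of good closed walks of length `2 m` on `r` vertices. It is compared with the
moments of a matrix whose entries take the values `2` and `-1` with probabilities `1/3`, `2/3`. -/
theorem card_isGoodWalk_le {r L m : ℕ} (hL : L + 1 = 2 * m) (hr : 0 < r) (hmr : 2 * m ≤ r)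
    [DecidablePred fun u : Fin (L + 1) → Fin r => IsGoodWalk u] :
    ((Finset.univ.filter fun u : Fin (L + 1) → Fin r => IsGoodWalk u).card : ℝ) ≤
      r ^ (m + 1) * momentBase ^ r := by
  classical
  -- A good walk may traverse an edge an odd number of times, so odd moments from the third on must
  -- be at least one as well. This excludes symmetric signs and calls for a skewed centred law.
  let ν : Measure Bool := bernoulliMeasure true false ⟨1 / 3, by norm_num, by norm_num⟩
  let h : Bool → ℝ := fun b => if b then 2 else -1
  have h0 : ∫ x, h x ∂ν = 0 := by
    rw [integral_bernoulliMeasure]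
    norm_num [h]
  have h2 : ∀ c, 2 ≤ c → 1 ≤ ∫ x, h x ^ c ∂ν := by
    intro c hc
    rw [integral_bernoulliMeasure]
    rcases hc.eq_or_lt with rfl | hc
    · norm_num [h]
    · have e1 : (2 : ℝ) ^ 3 ≤ 2 ^ c := pow_le_pow_right₀ (by norm_num) hc
      have e2 : -1 ≤ (-1 : ℝ) ^ c := by
        rcases neg_one_pow_eq_or ℝ c with h | h <;> simp [h]
      simp only [h, smul_eq_mul, if_true, Bool.false_eq_true, if_false]
      linarith
  have e1 := card_isGoodWalk_le_integral (fun _ : VertexPair r => ν) (fun _ => h) (fun _ => h0)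
    (fun _ => h2) L
  have e2 := integral_trace_pow_le_of_bounded (ν := ν) (h := h)
    (by intro b; cases b <;> norm_num [h]) h0 hr hmr
  rw [← hL] at e2
  refine le_trans (le_of_eq ?_) (e1.trans e2)
  congr!

/-! ### Norm bound for sparse random matrices. -/

section Norm

variable {X : Type*} [MeasurableSpace X] [Finite X] [MeasurableSingletonClass X] {n : ℕ}
  (μ : VertexPair n → Measure X) [∀ e, IsProbabilityMeasure (μ e)] (h : VertexPair n → X → ℝ)
  {p : ℝ}

theorem integral_trace_pow_le_mul (hp0 : 0 ≤ p) (hp1 : p ≤ 1)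
    (h1 : ∀ e, ∫ x, h e x ∂μ e = 0) (h2 : ∀ e c, 2 ≤ c → |∫ x, h e x ^ c ∂μ e| ≤ p)
    {r m : ℕ} (hm : 0 < m) (hr : n * p + 2 * m ≤ r) :
    ∫ ω, (symMatrix (fun e => h e (ω e)) ^ (2 * m)).trace ∂Measure.pi μ ≤
      n * (r ^ m * momentBase ^ r) := by
  classical
  obtain ⟨L, hL⟩ : ∃ L, L + 1 = 2 * m := ⟨2 * m - 1, by omega⟩
  have hmr : 2 * m ≤ r := by
    have : ((2 * m : ℕ) : ℝ) ≤ r := by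
      push_cast
      linarith [show 0 ≤ (n : ℝ) * p by positivity]
    exact_mod_cast this
  have hr0 : 0 < r := by omega
  have hr0' : (0 : ℝ) < r := by exact_mod_cast hr0
  have e1 := integral_trace_pow_le μ h hp0 hp1 h1 h2 L
  have e2 := sum_isGoodWalk_le (L := L) (n := n) (r := r) hp0 (by rw [hL]; exact_mod_cast hr)
  have e3 := card_isGoodWalk_le hL hr0 hmr
  rw [← hL]
  refine le_of_mul_le_mul_left ?_ hr0'
  calc _ ≤ _ := mul_le_mul_of_nonneg_left e1 hr0'.le
    _ ≤ _ := e2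
    _ ≤ n * (r ^ (m + 1) * momentBase ^ r) := mul_le_mul_of_nonneg_left e3 (Nat.cast_nonneg n)
    _ = _ := by ring

/-- Norm bound without logarithmic loss for random symmetric matrices with independent centred
entries. -/
theorem quadratic_bound_probability (hp0 : 0 ≤ p) (hp1 : p ≤ 1)
    (h1 : ∀ e, ∫ x, h e x ∂μ e = 0) (h2 : ∀ e c, 2 ≤ c → |∫ x, h e x ^ c ∂μ e| ≤ p)
    {b m : ℕ} (hm : 0 < m) (hb : 0 < b) (hr : n * p + 2 * m ≤ (b * m : ℕ)) :
    1 - n * Real.exp (-(2 * m)) ≤ (Measure.pi μ).real {ω | ∀ x : Fin n → ℝ,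
      |x ⬝ᵥ (Matrix.mulVec (symMatrix fun e => h e (ω e)) x)| ≤
        √(Real.exp 2 * momentBase ^ b * (b * m : ℕ)) * (x ⬝ᵥ x)} := by
  set r := b * m with hrdef
  have hr0 : (0 : ℝ) < r := by exact_mod_cast Nat.mul_pos hb hm
  have hK := momentBase_pos
  set T := √(Real.exp 2 * momentBase ^ b * r) with hT
  have hT0 : 0 < T := by positivity
  -- Because `r = b m`, the factor `momentBase ^ r` is an `m`-th power and fits into `T²`. The extra
  -- `exp 2` in `T²` is what Markov's inequality turns into the probability `n exp(-2m)`.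
  have hTm : T ^ (2 * m) = Real.exp (2 * m) * (r ^ m * momentBase ^ r) := by
    rw [pow_mul, hT, Real.sq_sqrt (by positivity), mul_pow, mul_pow, ← pow_mul, ← hrdef,
      ← Real.exp_nat_mul, mul_comm (m : ℝ) 2]
    ring
  set tr : (VertexPair n → X) → ℝ := fun ω => (symMatrix (fun e => h e (ω e)) ^ (2 * m)).trace
  have htr : ∀ ω, 0 ≤ tr ω := fun ω => by
    have := (symMatrix_isHermitian fun e => h e (ω e)).trace_pow (2 * m)
    simp only [tr, this]
    exact Finset.sum_nonneg fun i _ => (even_two_mul m).pow_nonneg _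
  have hmk : T ^ (2 * m) * (Measure.pi μ).real {ω | T ^ (2 * m) ≤ tr ω} ≤ ∫ ω, tr ω ∂Measure.pi μ :=
    mul_meas_ge_le_integral_of_nonneg (ae_of_all _ htr) Integrable.of_finite _
  have hI := integral_trace_pow_le_mul μ h hp0 hp1 h1 h2 hm hr
  have hP : (Measure.pi μ).real {ω | T ^ (2 * m) ≤ tr ω} ≤ n * Real.exp (-(2 * m)) := by
    refine le_of_mul_le_mul_left ?_ (pow_pos hT0 (2 * m))
    refine (hmk.trans hI).trans (le_of_eq ?_)
    rw [hTm, Real.exp_neg]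
    field_simp
  have hc := probReal_compl_eq_one_sub (μ := Measure.pi μ)
    (Set.toFinite {ω | T ^ (2 * m) ≤ tr ω}).measurableSet
  calc 1 - n * Real.exp (-(2 * m)) ≤ (Measure.pi μ).real {ω | T ^ (2 * m) ≤ tr ω}ᶜ := by
        rw [hc]; linarith
    _ ≤ _ := by
        refine measureReal_mono fun ω hω x => ?_
        have hω' : tr ω < T ^ (2 * m) := by simpa using hω
        exact (symMatrix_isHermitian _).abs_quadratic_le_of_trace_pow_le hT0.le hm.ne' hω'.le x

end Norm

/-! ### Mean and noise of the signed block model. -/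

/-- The matrix entry encoded by the two bits of a vertex pair. -/
noncomputable def edgeValue (x : Bool × Bool) : ℝ :=
  (if x.1 then 1 else 0) * (1 - 2 * (if x.2 then 1 else 0))

theorem signedAdjacency_eq {n : ℕ} (ω : VertexPair n → Bool × Bool) :
    signedAdjacency ω = symMatrix fun e => edgeValue (ω e) := rfl

theorem abs_edgeValue_le (x : Bool × Bool) : |edgeValue x| ≤ 1 := by
  rcases x with ⟨_ | _, _ | _⟩ <;> norm_num [edgeValue]

theorem integral_edgeValue (P S : unitInterval) :
    ∫ x, edgeValue x ∂(bernoulliMeasure true false P).prod (bernoulliMeasure true false S) =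
      P * (1 - 2 * S) := by
  rw [integral_prod _ Integrable.of_finite]
  simp [integral_bernoulliMeasure, edgeValue]
  exact Or.inl (by ring)

theorem integral_edgeValue_sq (P S : unitInterval) :
    ∫ x, edgeValue x ^ 2 ∂(bernoulliMeasure true false P).prod (bernoulliMeasure true false S) =
      P := by
  rw [integral_prod _ Integrable.of_finite]
  simp [integral_bernoulliMeasure, edgeValue]
  norm_num

/-- Halving brings the centred entry into `[-1, 1]`, so its higher moments are at most the second,
which is at most the variance `P - a²`. -/
theorem abs_integral_centered_pow_le (P S : unitInterval) {c : ℕ} (hc : 2 ≤ c) :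
    |∫ x, ((edgeValue x - P * (1 - 2 * S)) / 2) ^ c
      ∂(bernoulliMeasure true false P).prod (bernoulliMeasure true false S)| ≤ P := by
  set μ := (bernoulliMeasure true false P).prod (bernoulliMeasure true false S)
  set a : ℝ := P * (1 - 2 * S) with ha
  have hP := P.2
  have hS := S.2
  have ha1 : |a| ≤ 1 := by
    rw [ha, abs_mul, abs_of_nonneg hP.1]
    exact mul_le_one₀ hP.2 (abs_nonneg _) (abs_le.mpr ⟨by linarith [hS.2], by linarith [hS.1]⟩)
  have hb : ∀ x, |(edgeValue x - a) / 2| ≤ 1 := by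
    intro x
    have h1 := abs_sub (edgeValue x) a
    have h2 := abs_edgeValue_le x
    rw [abs_div, abs_two]
    linarith
  calc _ ≤ ∫ x, |((edgeValue x - a) / 2) ^ c| ∂μ := abs_integral_le_integral_abs
    _ ≤ ∫ x, (edgeValue x ^ 2 - 2 * a * edgeValue x + a ^ 2) ∂μ := by
        refine integral_mono Integrable.of_finite Integrable.of_finite fun x => ?_
        simp only
        rw [abs_pow]
        calc _ ≤ |(edgeValue x - a) / 2| ^ 2 := pow_le_pow_of_le_one (abs_nonneg _) (hb x) hc
          _ ≤ _ := by
            rw [sq_abs]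
            nlinarith [sq_nonneg (edgeValue x - a)]
    _ = P - a ^ 2 := by
        rw [integral_add Integrable.of_finite Integrable.of_finite,
          integral_sub Integrable.of_finite Integrable.of_finite, integral_const_mul,
          integral_edgeValue, integral_edgeValue_sq]
        simp only [integral_const, probReal_univ, one_smul, ← ha]
        ring
    _ ≤ P := by linarith [sq_nonneg a]

theorem integral_centered (P S : unitInterval) :
    ∫ x, (edgeValue x - P * (1 - 2 * S)) / 2
      ∂(bernoulliMeasure true false P).prod (bernoulliMeasure true false S) = 0 := by
  rw [integral_div, integral_sub Integrable.of_finite Integrable.of_finite, integral_edgeValue]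
  simp

/-- The sign of a vertex: `1` in the first community, `-1` in the second. -/
noncomputable def communitySign (k : ℕ) (i : Fin (2 * k)) : ℝ := if (i : ℕ) < k then 1 else -1

theorem communitySign_sq (k : ℕ) (i : Fin (2 * k)) :
    communitySign k i * communitySign k i = 1 := by
  unfold communitySign
  split_ifs <;> norm_num

theorem sum_communitySign (k : ℕ) : ∑ i, communitySign k i = 0 := by
  unfold communitySign
  rw [Fin.sum_univ_eq_sum_range (fun i : ℕ => if i < k then (1 : ℝ) else -1) (2 * k), two_mul,
    Finset.sum_range_add]
  have h1 : ∑ i ∈ Finset.range k, (if i < k then (1 : ℝ) else -1) = k := by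
    rw [Finset.sum_congr rfl fun i hi => if_pos (Finset.mem_range.mp hi)]
    simp
  have h2 : ∑ i ∈ Finset.range k, (if k + i < k then (1 : ℝ) else -1) = -k := by
    simp
  rw [h1, h2]; ring

/-- Across communities the sign bias is reversed, so the mean is `-(1-2s)q` there against `(1-2s)p`
inside. This is why the sign vector carries `p + q` and the constant vector `p - q`. -/
theorem blockExtend_mean (k : ℕ) (p q s : unitInterval) (e : VertexPair (2 * k)) :
    (blockExtend (bisection k) !![p, q; q, p] e.1.1 e.1.2 : ℝ) *
      (1 - 2 * (blockExtend (bisection k)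
        !![s, unitInterval.symm s; unitInterval.symm s, s] e.1.1 e.1.2 : ℝ)) =
    (1 - 2 * s) * (((p : ℝ) - q) / 2 +
      ((p : ℝ) + q) / 2 * (communitySign k e.1.1 * communitySign k e.1.2)) := by
  have hne : e.1.1 ≠ e.1.2 := e.2.ne
  unfold blockExtend bisection communitySign
  simp only [Matrix.of_apply, hne, if_false]
  split_ifs <;> simp <;> ring

theorem blockExtend_le (k : ℕ) {p q : unitInterval} (hqp : (q : ℝ) ≤ p) (e : VertexPair (2 * k)) :
    (blockExtend (bisection k) !![p, q; q, p] e.1.1 e.1.2 : ℝ) ≤ p := by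
  have hne : e.1.1 ≠ e.1.2 := e.2.ne
  unfold blockExtend bisection
  simp only [Matrix.of_apply, hne, if_false]
  split_ifs <;> simp [hqp]

/-- The quadratic form of a symmetric matrix with two-community entries. -/
theorem quadratic_symMatrix_communities (k : ℕ) (a b : ℝ) (x : Fin (2 * k) → ℝ) :
    x ⬝ᵥ (Matrix.mulVec (symMatrix fun e =>
      a + b * (communitySign k e.1.1 * communitySign k e.1.2)) x) =
    b * (communitySign k ⬝ᵥ x) ^ 2 + a * (∑ i, x i) ^ 2 - (a + b) * (x ⬝ᵥ x) := by
  have hM : ∀ i j, symMatrix (fun e : VertexPair (2 * k) =>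
      a + b * (communitySign k e.1.1 * communitySign k e.1.2)) i j =
      a + b * (communitySign k i * communitySign k j) - if i = j then a + b else 0 := by
    intro i j
    rcases lt_trichotomy i j with h | rfl | h
    · simp [symMatrix, h, h.ne]
    · simp [symMatrix, communitySign_sq]
    · simp [symMatrix, h, h.not_gt, h.ne', mul_comm (communitySign k j)]
  have h1 : (communitySign k ⬝ᵥ x) ^ 2 =
      ∑ i, ∑ j, communitySign k i * x i * (communitySign k j * x j) := by
    rw [sq, dotProduct, Finset.sum_mul_sum]
  have h2 : (∑ i, x i) ^ 2 = ∑ i, ∑ j, x i * x j := by rw [sq, Finset.sum_mul_sum]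
  rw [h1, h2]
  simp only [dotProduct, Matrix.mulVec, hM, Finset.mul_sum, ← Finset.sum_add_distrib]
  rw [← Finset.sum_sub_distrib]
  refine Finset.sum_congr rfl fun i _ => ?_
  have : (a + b) * (x i * x i) = ∑ j, if i = j then (a + b) * (x i * x j) else 0 := by simp
  rw [this, ← Finset.sum_sub_distrib]
  refine Finset.sum_congr rfl fun j _ => ?_
  split_ifs <;> ring

/-- The law of the two bits of a vertex pair in `signedErdosRenyi`. -/
noncomputable def pairLaw {n : ℕ} (P S : Matrix (Fin n) (Fin n) unitInterval) (e : VertexPair n) :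
    Measure (Bool × Bool) :=
  (bernoulliMeasure true false (P e.1.1 e.1.2)).prod (bernoulliMeasure true false (S e.1.1 e.1.2))

instance {n : ℕ} (P S : Matrix (Fin n) (Fin n) unitInterval) (e : VertexPair n) :
    IsProbabilityMeasure (pairLaw P S e) := by
  unfold pairLaw; infer_instance

/-- Half the deviation of a matrix entry of `signedErdosRenyi` from its mean. -/
noncomputable def halfDeviation {n : ℕ} (P S : Matrix (Fin n) (Fin n) unitInterval)
    (e : VertexPair n) (x : Bool × Bool) : ℝ :=
  (edgeValue x - P e.1.1 e.1.2 * (1 - 2 * S e.1.1 e.1.2)) / 2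

open Matrix in
theorem quadratic_signedAdjacency {n : ℕ} (P S : Matrix (Fin n) (Fin n) unitInterval)
    (ω : VertexPair n → Bool × Bool) (x : Fin n → ℝ) :
    x ⬝ᵥ (signedAdjacency ω *ᵥ x) =
      x ⬝ᵥ (symMatrix (fun e => (P e.1.1 e.1.2 : ℝ) * (1 - 2 * S e.1.1 e.1.2)) *ᵥ x) +
      2 * (x ⬝ᵥ (symMatrix (fun e => halfDeviation P S e (ω e)) *ᵥ x)) := by
  rw [signedAdjacency_eq, dotProduct_symMatrix_mulVec, dotProduct_symMatrix_mulVec,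
    dotProduct_symMatrix_mulVec, Finset.mul_sum, ← Finset.sum_add_distrib]
  refine Finset.sum_congr rfl fun e _ => ?_
  unfold halfDeviation
  ring

-- In the error, `2 * T` undoes the halving of the noise, and `1` bounds the diagonal correction
-- `(1-2s)p`.
open Matrix in
theorem eigenvalues₀_signedAdjacency {k : ℕ} (hk : 0 < k) {p q s : unitInterval}
    (hqp : (q : ℝ) ≤ p) (hs : (s : ℝ) ≤ 1 / 2) (ω : VertexPair (2 * k) → Bool × Bool) {T : ℝ}
    (hT : ∀ x : Fin (2 * k) → ℝ, |x ⬝ᵥ (symMatrix (fun e =>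
      halfDeviation (blockExtend (bisection k) !![p, q; q, p])
        (blockExtend (bisection k) !![s, unitInterval.symm s; unitInterval.symm s, s]) e (ω e)) *ᵥ
          x)| ≤ T * (x ⬝ᵥ x))
    (hA : (signedAdjacency ω).IsHermitian) (j : Fin (Fintype.card (Fin (2 * k)))) :
    |hA.eigenvalues₀ j - (if (j : ℕ) = 0 then (1 - 2 * (s : ℝ)) * (p + q) * k
      else if (j : ℕ) = 1 then (1 - 2 * (s : ℝ)) * (p - q) * k else 0)| ≤ 2 * T + 1 := by
  have hp := p.2
  have hq := q.2
  have hs' := s.2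
  have hk' : (0 : ℝ) < k := by exact_mod_cast hk
  set c : ℝ := (√(2 * k))⁻¹ with hc
  have hc2 : c * c * (2 * k) = 1 := by
    rw [hc, ← sq, inv_pow, Real.sq_sqrt (by positivity)]
    field_simp
  refine hA.eigenvalues₀_near_rank_two (u := c • communitySign k) (v := c • 1) ?_ ?_ ?_ ?_ ?_ ?_ j
  · rw [smul_dotProduct, dotProduct_smul, dotProduct]
    simp only [communitySign_sq, Finset.sum_const, Finset.card_univ, Fintype.card_fin,
      nsmul_eq_mul, smul_eq_mul]
    push_cast
    linarith
  · rw [smul_dotProduct, dotProduct_smul, one_dotProduct]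
    simp only [Pi.one_apply, Finset.sum_const, Finset.card_univ, Fintype.card_fin,
      nsmul_eq_mul, smul_eq_mul]
    push_cast
    linarith
  · rw [smul_dotProduct, dotProduct_smul, dotProduct_one, sum_communitySign, smul_zero, smul_zero]
  · exact mul_nonneg (mul_nonneg (by linarith) (by linarith)) hk'.le
  · exact mul_le_mul_of_nonneg_right (mul_le_mul_of_nonneg_left (by linarith [hq.1])
      (by linarith)) hk'.le
  · intro x
    have hx : 0 ≤ x ⬝ᵥ x := by simpa using dotProduct_star_self_nonneg x
    rw [quadratic_signedAdjacency (blockExtend (bisection k) !![p, q; q, p])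
        (blockExtend (bisection k) !![s, unitInterval.symm s; unitInterval.symm s, s])]
    simp only [blockExtend_mean]
    have hm : (fun e : VertexPair (2 * k) => (1 - 2 * (s : ℝ)) * (((p : ℝ) - q) / 2 +
        ((p : ℝ) + q) / 2 * (communitySign k e.1.1 * communitySign k e.1.2))) = fun e =>
        (1 - 2 * (s : ℝ)) * (((p : ℝ) - q) / 2) + (1 - 2 * (s : ℝ)) * (((p : ℝ) + q) / 2) *
          (communitySign k e.1.1 * communitySign k e.1.2) := by
      funext e; ring
    rw [hm]
    rw [quadratic_symMatrix_communities]
    have h1 : ((c • communitySign k) ⬝ᵥ x) ^ 2 * (2 * k) = (communitySign k ⬝ᵥ x) ^ 2 := by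
      rw [smul_dotProduct, smul_eq_mul]
      linear_combination (communitySign k ⬝ᵥ x) ^ 2 * hc2
    have h2 : ((c • (1 : Fin (2 * k) → ℝ)) ⬝ᵥ x) ^ 2 * (2 * k) = (∑ i, x i) ^ 2 := by
      rw [smul_dotProduct, smul_eq_mul, one_dotProduct]
      linear_combination (∑ i, x i) ^ 2 * hc2
    have h3 := abs_le.mp (hT x)
    have h4 : 0 ≤ (1 - 2 * (s : ℝ)) * p := mul_nonneg (by linarith) hp.1
    have h5 : (1 - 2 * (s : ℝ)) * p ≤ 1 := mul_le_one₀ (by linarith [hs'.1]) hp.1 hp.2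
    have h6 := mul_le_mul_of_nonneg_right h5 hx
    have h7 := mul_nonneg h4 hx
    rw [← h1, ← h2, abs_le]
    constructor <;> linarith [h3.1, h3.2]

/-! ### Transfer of probabilities and the final estimate. -/

theorem measurable_signedAdjacency (n : ℕ) :
    Measurable (signedAdjacency : (VertexPair n → Bool × Bool) → _) :=
  measurable_of_finite _

instance (n : ℕ) : MeasurableSingletonClass (Matrix (Fin n) (Fin n) ℝ) :=
  inferInstanceAs (MeasurableSingletonClass (Fin n → Fin n → ℝ))

/-- Events about the random signed graph transfer to any random matrix with the law of its signed
adjacency matrix. -/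
theorem measureReal_ge_of_hasLaw_signedErdosRenyi {n : ℕ}
    {P S : Matrix (Fin n) (Fin n) unitInterval} {Ω : Type*} [MeasurableSpace Ω] {μ : Measure Ω}
    [IsProbabilityMeasure μ] {A : Ω → Matrix (Fin n) (Fin n) ℝ}
    (hA : HasLaw A (signedErdosRenyi P S) μ) (G : Set (VertexPair n → Bool × Bool))
    {E : Set Ω} (hE : ∀ ω, A ω ∈ signedAdjacency '' G → ω ∈ E) :
    (Measure.pi (pairLaw P S)).real G ≤ μ.real E := by
  -- The image is finite, hence measurable, so `E` itself needs no measurability.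
  have hB : MeasurableSet (signedAdjacency '' G) := (Set.toFinite _).measurableSet
  have h1 : μ.real {ω | A ω ∈ signedAdjacency '' G} =
      (Measure.pi (pairLaw P S)).real (signedAdjacency ⁻¹' (signedAdjacency '' G)) := by
    rw [hA.measureReal_eq (p := fun M => M ∈ signedAdjacency '' G) hB]
    exact map_measureReal_apply (measurable_signedAdjacency n) hB
  calc _ ≤ (Measure.pi (pairLaw P S)).real (signedAdjacency ⁻¹' (signedAdjacency '' G)) :=
        measureReal_mono (Set.subset_preimage_image _ _)
    _ = μ.real {ω | A ω ∈ signedAdjacency '' G} := h1.symm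
    _ ≤ μ.real E := measureReal_mono hE

theorem signedBlock_quadratic_bound_probability {k : ℕ} {p q s : unitInterval}
    (hqp : (q : ℝ) ≤ p) {b m : ℕ} (hm : 0 < m) (hb : 0 < b)
    (hr : (2 * k : ℕ) * (p : ℝ) + 2 * m ≤ (b * m : ℕ)) :
    1 - (2 * k : ℕ) * Real.exp (-(2 * m)) ≤
      (Measure.pi (pairLaw (blockExtend (bisection k) !![p, q; q, p])
        (blockExtend (bisection k) !![s, unitInterval.symm s; unitInterval.symm s, s]))).real
      {ω | ∀ x : Fin (2 * k) → ℝ, |x ⬝ᵥ (Matrix.mulVec (symMatrix fun e =>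
        halfDeviation (blockExtend (bisection k) !![p, q; q, p])
        (blockExtend (bisection k) !![s, unitInterval.symm s; unitInterval.symm s, s]) e (ω e)) x)|
        ≤ √(Real.exp 2 * momentBase ^ b * (b * m : ℕ)) * (x ⬝ᵥ x)} :=
  quadratic_bound_probability _ _ p.2.1 p.2.2 (fun _ => integral_centered _ _)
    (fun e _ hc => (abs_integral_centered_pow_le _ _ hc).trans (blockExtend_le k hqp e)) hm hb hr

theorem two_mul_exp_le_rpow {k w : ℕ} (hk : 2 ≤ k) (hw : √(k : ℝ) ≤ w) :
    (2 * k : ℕ) * Real.exp (-(2 * (4 * w : ℕ))) ≤ (k : ℝ) ^ (-2 : ℝ) := by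
  have hk' : (2 : ℝ) ≤ k := by exact_mod_cast hk
  -- With `m = 4 w` the exponential is `exp(w)^8 ≥ (√k)^8`; the union factor satisfies `2k ≤ k²`,
  -- leaving `k^(-2)`.
  have h1 : (k : ℝ) ^ 4 ≤ Real.exp (2 * (4 * w : ℕ)) := by
    have h2 : √(k : ℝ) ≤ Real.exp w := by linarith [Real.add_one_le_exp (w : ℝ)]
    calc (k : ℝ) ^ 4 = (√(k : ℝ)) ^ 8 := by
          rw [show 8 = 2 * 4 from rfl, pow_mul, Real.sq_sqrt (by positivity)]
      _ ≤ Real.exp w ^ 8 := pow_le_pow_left₀ (Real.sqrt_nonneg _) h2 8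
      _ = _ := by
          rw [← Real.exp_nat_mul]
          congr 1
          push_cast
          ring
  rw [Real.exp_neg, Real.rpow_neg (by positivity), show (2 : ℝ) = (2 : ℕ) by norm_num,
    Real.rpow_natCast]
  have h3 : (0 : ℝ) < (k : ℝ) ^ 2 := by positivity
  calc ((2 * k : ℕ) : ℝ) * (Real.exp (2 * (4 * w : ℕ)))⁻¹ ≤ (k ^ 2 : ℝ) * ((k : ℝ) ^ 4)⁻¹ := by
        refine mul_le_mul ?_ (inv_anti₀ (by positivity) h1) (by positivity) (by positivity)
        push_cast
        nlinarith
    _ = ((k : ℝ) ^ 2)⁻¹ := by field_simp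

theorem corollary4p2 (γ₁ γ₂ : ℝ) (s : unitInterval) (hγ₂ : 0 < γ₂) (hγ : γ₂ < γ₁)
    (hs₀ : 0 < (s : ℝ)) (hs : (s : ℝ) < 1 / 2) :
    ∃ C : ℝ, 0 < C ∧ ∃ ε : ℕ → ℝ, Tendsto ε atTop (𝓝 0) ∧
      ∀ (k : ℕ) (p q : unitInterval), 2 ≤ k →
        (p : ℝ) = γ₁ * (k : ℝ) ^ (-(1 / 2) : ℝ) →
        (q : ℝ) = γ₂ * (k : ℝ) ^ (-(1 / 2) : ℝ) →
        (p : ℝ) < 1 →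
        ∀ {Ω : Type*} [MeasurableSpace Ω] (μ : Measure Ω) [IsProbabilityMeasure μ]
          (A : Ω → Matrix (Fin (2 * k)) (Fin (2 * k)) ℝ), HasLaw A (signedBlock k p q s) μ →
          1 - (k : ℝ) ^ (-2 : ℝ) ≤ μ.real {ω | ∃ hA : (A ω).IsHermitian,
            |ascEigenvalue hA (2 * k) - (1 - 2 * (s : ℝ)) * (γ₁ + γ₂) * √(k : ℝ)|
              ≤ C * (k : ℝ) ^ (1 / 4 : ℝ) + ε k ∧
            |ascEigenvalue hA (2 * k - 1) - (1 - 2 * (s : ℝ)) * (γ₁ - γ₂) * √(k : ℝ)|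
              ≤ C * (k : ℝ) ^ (1 / 4 : ℝ) + ε k ∧
            ∀ ℓ : ℕ, 1 ≤ ℓ → ℓ < 2 * k - 1 →
              |ascEigenvalue hA ℓ| ≤ C * (k : ℝ) ^ (1 / 4 : ℝ) + ε k} := by
  -- Chosen so that `r = b m` with `m = 4 ⌈√k⌉` is at least `2kp + 2m`: the ceiling covers `2kp = 2
  -- γ₁ √k`, and the summand `2` covers `2m`. In `D`, the factor `8 b` comes from `r ≤ 8 b √k`.
  set b : ℕ := ⌈γ₁⌉₊ + 2 with hb
  have hK := momentBase_pos
  set D : ℝ := Real.exp 2 * momentBase ^ b * (8 * b) with hD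
  have hD0 : 0 < D := by
    have : (0 : ℝ) < b := by rw [hb]; positivity
    positivity
  -- The error sequence can be zero, since the additive `1` is absorbed by `k^(1/4) ≥ 1`.
  refine ⟨2 * √D + 1, by positivity, fun _ => 0, tendsto_const_nhds, ?_⟩
  intro k p q hk hp hq _ Ω _ μ _ A hA
  have hk1 : (1 : ℝ) ≤ k := by exact_mod_cast (by omega : 1 ≤ k)
  have hsqrt : (k : ℝ) ^ (-(1 / 2) : ℝ) * k = √(k : ℝ) := by
    rw [Real.rpow_neg (by positivity), ← Real.sqrt_eq_rpow]
    field_simp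
    rw [Real.sq_sqrt (by positivity)]
  have hsqrt1 : 1 ≤ √(k : ℝ) := Real.one_le_sqrt.mpr hk1
  have hqp : (q : ℝ) ≤ p := by
    rw [hp, hq]
    exact mul_le_mul_of_nonneg_right hγ.le (by positivity)
  set w : ℕ := ⌈√(k : ℝ)⌉₊ with hw
  have hw1 : √(k : ℝ) ≤ w := Nat.le_ceil _
  have hw2 : (w : ℝ) ≤ 2 * √(k : ℝ) := by
    linarith [Nat.ceil_lt_add_one (Real.sqrt_nonneg (k : ℝ))]
  have hw0 : 0 < w := Nat.ceil_pos.mpr (by linarith)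
  have hr : ((2 * k : ℕ) : ℝ) * (p : ℝ) + 2 * (4 * w : ℕ) ≤ (b * (4 * w) : ℕ) := by
    have h1 : (k : ℝ) * p = γ₁ * √(k : ℝ) := by rw [hp, ← hsqrt]; ring
    have h2 : γ₁ * √(k : ℝ) ≤ ⌈γ₁⌉₊ * w :=
      mul_le_mul (Nat.le_ceil _) hw1 (Real.sqrt_nonneg _) (Nat.cast_nonneg _)
    rw [hb]
    push_cast
    have h3 : (0 : ℝ) ≤ (⌈γ₁⌉₊ : ℝ) * w := by positivity
    linarith
  set T := √(Real.exp 2 * momentBase ^ b * (b * (4 * w) : ℕ)) with hT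
  have hk4 : √(√(k : ℝ)) = (k : ℝ) ^ (1 / 4 : ℝ) := by
    rw [Real.sqrt_eq_rpow, Real.sqrt_eq_rpow, ← Real.rpow_mul (by positivity)]
    norm_num
  have hTD : T ≤ √D * (k : ℝ) ^ (1 / 4 : ℝ) := by
    rw [← hk4, ← Real.sqrt_mul hD0.le, hT, hD]
    apply Real.sqrt_le_sqrt
    have h1 : ((b * (4 * w) : ℕ) : ℝ) ≤ 8 * b * √(k : ℝ) := by
      push_cast
      nlinarith [Nat.cast_nonneg (α := ℝ) b]
    calc _ ≤ Real.exp 2 * momentBase ^ b * (8 * b * √(k : ℝ)) :=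
          mul_le_mul_of_nonneg_left h1 (by positivity)
      _ = _ := by ring
  have hbound : 2 * T + 1 ≤ (2 * √D + 1) * (k : ℝ) ^ (1 / 4 : ℝ) + 0 := by
    have : 1 ≤ (k : ℝ) ^ (1 / 4 : ℝ) := Real.one_le_rpow hk1 (by norm_num)
    linarith
  have hα : (1 - 2 * (s : ℝ)) * (p + q) * k = (1 - 2 * (s : ℝ)) * (γ₁ + γ₂) * √(k : ℝ) := by
    rw [← hsqrt, hp, hq]; ring
  have hβ : (1 - 2 * (s : ℝ)) * (p - q) * k = (1 - 2 * (s : ℝ)) * (γ₁ - γ₂) * √(k : ℝ) := by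
    rw [← hsqrt, hp, hq]; ring
  have hprob := signedBlock_quadratic_bound_probability (s := s) hqp (m := 4 * w) (b := b)
    (by omega) (by omega) hr
  refine le_trans ?_ (hprob.trans (measureReal_ge_of_hasLaw_signedErdosRenyi hA _ ?_))
  · linarith [two_mul_exp_le_rpow hk hw1]
  · rintro ω ⟨G, hG, hGA⟩
    have hAH : (A ω).IsHermitian := by rw [← hGA, signedAdjacency_eq]; exact symMatrix_isHermitian _
    refine ⟨hAH, ?_⟩
    generalize A ω = M at hGA hAH
    subst hGA
    have hev := fun j => (eigenvalues₀_signedAdjacency (by omega) hqp hs.le G hG hAH j).trans hbound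
    rw [hα, hβ] at hev
    refine ⟨?_, ?_, fun ℓ h1 h2 => ?_⟩
    · unfold ascEigenvalue
      rw [dif_pos (by omega)]
      simpa using hev ⟨2 * k - 2 * k, by rw [Fintype.card_fin]; omega⟩
    · unfold ascEigenvalue
      rw [dif_pos (by omega)]
      have := hev ⟨2 * k - (2 * k - 1), by rw [Fintype.card_fin]; omega⟩
      rwa [if_neg (by simp only; omega), if_pos (by simp only; omega)] at this
    · unfold ascEigenvalue
      rw [dif_pos (by omega)]
      have := hev ⟨2 * k - ℓ, by rw [Fintype.card_fin]; omega⟩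
      rwa [if_neg (by simp only; omega), if_neg (by simp only; omega), sub_zero] at this
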